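/- Let $r$ be a prime and let $G$ be a finite group. Let $O_r(G)$ be the largest normal $r$-subgroup of $G$. Suppose that $O_r(G) \neq 1$, that $X := G/O_r(G) \cong \mathrm{PSL}_2(49)$, and that $G$ has an element $g$ of order $5$ acting fixed-point-freely on $O_r(G)$ by conjugation (that is, the only $x \in O_r(G)$ with $gxg^{-1} = x$ is $x = 1$). Then $r = 7$, and $O_7(G)$ is elementary abelian and, with the action of $X$ induced by conjugation in $G$, completely reducible as a $\mathrm{GF}(7)X$-module. -/

import Mathlib

/-- `O_p(G)`: the subgroup generated by all normal `p`-subgroups of `G`. For finite `G` it is the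
largest normal `p`-subgroup. -/
def pCore (p : ℕ) (G : Type*) [Group G] : Subgroup G :=
  sSup {N : Subgroup G | N.Normal ∧ IsPGroup p N}

instance pCore_normal (p : ℕ) (G : Type*) [Group G] : (pCore p G).Normal := by
  unfold pCore
  rw [sSup_eq_iSup']
  have h : ∀ N : {N : Subgroup G | N.Normal ∧ IsPGroup p N}, (N : Subgroup G).Normal :=
    fun N => N.2.1
  infer_instance

/-- The element `g` acts fixed-point-freely by conjugation on the subgroup `N`. -/
def ActsFixedPointFreely {G : Type*} [Group G] (g : G) (N : Subgroup G) : Prop :=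
  ∀ x ∈ N, g * x * g⁻¹ = x → x = 1

/-- `A` is an elementary abelian `p`-group (possibly trivial). -/
structure IsElementaryAbelian (p : ℕ) (A : Type*) [Group A] : Prop where
  mul_comm : ∀ x y : A, x * y = y * x
  pow_eq_one : ∀ x : A, x ^ p = 1

namespace IsElementaryAbelian

/-- An elementary abelian `p`-group, written additively and regarded as a `GF(p)`-module. -/
def AsModule {p : ℕ} {A : Type*} [Group A] (_h : IsElementaryAbelian p A) : Type _ :=
  Additive A

instance {p : ℕ} {A : Type*} [Group A] (h : IsElementaryAbelian p A) :
    AddCommGroup h.AsModule :=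
  { (inferInstance : AddGroup (Additive A)) with
    add_comm := fun x y => h.mul_comm (Additive.toMul x) (Additive.toMul y) }

/-- The unique `ZMod p`-module structure on the abelian group `A`. -/
instance {p : ℕ} {A : Type*} [Group A] (h : IsElementaryAbelian p A) :
    Module (ZMod p) h.AsModule :=
  AddCommGroup.zmodModule (n := p) fun x => h.pow_eq_one (Additive.toMul x)

/-- An automorphism of `A`, regarded as a `GF(p)`-linear endomorphism. -/
def linearOfAut {p : ℕ} {A : Type*} [Group A] (h : IsElementaryAbelian p A) :
    MulAut A →* Module.End (ZMod p) h.AsModule where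
  toFun φ := AddMonoidHom.toZModLinearMap p
    ({ toFun := fun x => Additive.ofMul (φ (Additive.toMul x))
       map_zero' := map_one φ
       map_add' := fun x y => map_mul φ (Additive.toMul x) (Additive.toMul y) } :
      h.AsModule →+ h.AsModule)
  map_one' := rfl
  map_mul' _ _ := rfl

/-- For an elementary abelian normal subgroup `N` of `G`, the conjugation action of `G / N` on
`N`: the coset of `g` sends `x` to `g * x * g⁻¹`. -/
def conjQuotient {p : ℕ} {G : Type*} [Group G] {N : Subgroup G} [N.Normal]
    (h : IsElementaryAbelian p N) : G ⧸ N →* MulAut N :=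
  QuotientGroup.lift N MulAut.conjNormal fun n hn => by
    ext x
    have := congrArg Subtype.val (h.mul_comm ⟨n, hn⟩ x)
    simp only [Subgroup.coe_mul] at this
    simp [MulAut.conjNormal_apply, this]

/-- An elementary abelian normal subgroup `N` of `G` as a `GF(p)[G / N]`-module, the action
being induced by conjugation in `G`. -/
def conjRep {p : ℕ} {G : Type*} [Group G] {N : Subgroup G} [N.Normal]
    (h : IsElementaryAbelian p N) : Representation (ZMod p) (G ⧸ N) h.AsModule :=
  h.linearOfAut.comp h.conjQuotient

end IsElementaryAbelian

/-! The action of $G$ on an abelian characteristic section of $O_r(G)$ factors through $X$ once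
$O_r(G)$ acts trivially on the section, and can be pulled back to $\mathrm{SL}_2(49)$ with $-1$
acting trivially. The element of order 5 lifts to some $s$ of order 5 whose trace $t$ satisfies
$t^2+t-1=0$. Fixed-point-freeness passes to the section and says $1+s+s^2+s^3+s^4=0$ there.
Conjugating $s$ turns this single equation into the family of relations `IsPentagonal` in Bruhat
form, with unipotents $u(x)$, torus $h(c)$ and Weyl element $w$. Everything is deduced from these
relations.

The case $r=5$ is impossible because a 5-element has fixed points on a nontrivial 5-group. For $r\ne
5,7$, scalars are extended and the unipotent group is diagonalised with projectors $e_s$. Between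
$e_s$ and $e_{s'}$ a relation loses its term $1$ and becomes a two-term relation between
$e_s\,w\,h(c)\,e_{s'}$ and $e_s\,w\,h(ct)\,e_{s'}$. The torus supplies a second one with independent
coefficients, so both unknowns vanish; then all unipotents are trivial and the relation reads $5=0$
(`IsPentagonal.one_eq_zero`).

For $r=7$, write $D_x=u(x)-1$ and let $v$ be fixed by all $u(x)$. The relations force $h(t)v=-v$,
the vanishing of third differences of $wv$, and $D_xD_x(wv)=2N(x)v$ with $N$ the norm to
$\mathrm{GF}(7)$ (`IsPentagonal.diffForm_weyl`). So $v$, $wv$ and the differences of $wv$ span a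
simple module, of dimension 4 if $v\ne0$: the orthogonal module of $X\cong\Omega_4^-(7)$. Comparing
torus weights shows that nothing lies above the sum of these modules
(`IsPentagonal.fixedSpan_eq_top`), so an abelian $O_7(G)$ has exponent 7 and is semisimple.

Commutativity is by induction on the order. In class two the commutator is an equivariant biadditive
map from the abelianization to the center, and torus weights leave no such map except zero
(`equivariant_biadditive_eq_zero`). -/

/-! ### Generators and relations of $\mathrm{SL}_2$ -/

open Matrix in
/-- The upper unitriangular matrices in `SL₂`. -/
def sl2Upper {F : Type*} [Field F] (x : F) : SpecialLinearGroup (Fin 2) F :=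
  ⟨!![1, x; 0, 1], by simp [det_fin_two]⟩

open Matrix in
/-- The standard representative of the nontrivial Weyl group element of `SL₂`. -/
def sl2Weyl (F : Type*) [Field F] : SpecialLinearGroup (Fin 2) F :=
  ⟨!![0, -1; 1, 0], by simp [det_fin_two]⟩

open Matrix in
/-- The diagonal torus of `SL₂`. -/
def sl2Torus {F : Type*} [Field F] : Fˣ →* SpecialLinearGroup (Fin 2) F where
  toFun a := ⟨!![(a : F), 0; 0, (a⁻¹ : Fˣ)], by simp [det_fin_two]⟩
  map_one' := by ext i j; fin_cases i <;> fin_cases j <;> simp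
  map_mul' a b := Subtype.ext <| by
    change _ = !![(a : F), 0; 0, (a⁻¹ : Fˣ)] * !![(b : F), 0; 0, (b⁻¹ : Fˣ)]
    simp [mul_comm]

section SL2Relations

open Matrix

variable {F : Type*} [Field F]

lemma coe_sl2Upper (x : F) :
    (sl2Upper x : Matrix (Fin 2) (Fin 2) F) = !![1, x; 0, 1] := rfl

lemma coe_sl2Weyl : (sl2Weyl F : Matrix (Fin 2) (Fin 2) F) = !![0, -1; 1, 0] := rfl

lemma coe_sl2Torus (a : Fˣ) :
    (sl2Torus a : Matrix (Fin 2) (Fin 2) F) = !![(a : F), 0; 0, (a : F)⁻¹] := by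
  change !![(a : F), 0; 0, (a⁻¹ : Fˣ)] = _
  simp

lemma sl2Upper_zero : sl2Upper (0 : F) = 1 := by
  ext i j; fin_cases i <;> fin_cases j <;> simp [coe_sl2Upper]

lemma sl2Upper_add (x y : F) : sl2Upper (x + y) = sl2Upper x * sl2Upper y := by
  ext i j; fin_cases i <;> fin_cases j <;>
    simp [coe_sl2Upper, add_comm]

lemma sl2Torus_mul_upper (a : Fˣ) (x : F) :
    sl2Torus a * sl2Upper x = sl2Upper ((a : F) ^ 2 * x) * sl2Torus a := by
  ext i j; fin_cases i <;> fin_cases j <;>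
    simp [coe_sl2Upper, coe_sl2Torus]
  field_simp

lemma sl2Weyl_mul_torus (a : Fˣ) :
    sl2Weyl F * sl2Torus a = sl2Torus a⁻¹ * sl2Weyl F := by
  ext i j; fin_cases i <;> fin_cases j <;>
    simp [coe_sl2Weyl, coe_sl2Torus]

lemma sl2Weyl_mul_self : sl2Weyl F * sl2Weyl F = -1 := by
  ext i j; fin_cases i <;> fin_cases j <;>
    simp [coe_sl2Weyl]

/-- The rank-one relation: a lower unipotent, rewritten in the big Bruhat cell. It controls how $w$
acts on differences $D_x(wv)$. -/
lemma sl2Weyl_upper_weyl (x : Fˣ) :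
    sl2Weyl F * sl2Upper (x : F) * sl2Weyl F =
      sl2Upper (-(x : F)⁻¹) * (sl2Weyl F * sl2Torus x) * sl2Upper (-(x : F)⁻¹) := by
  ext i j; fin_cases i <;> fin_cases j <;>
    simp [coe_sl2Weyl, coe_sl2Upper, coe_sl2Torus]

lemma sl2_bruhat (s : SpecialLinearGroup (Fin 2) F) :
    (∃ a x, s = sl2Torus a * sl2Upper x) ∨
      ∃ x c y, s = sl2Upper x * (sl2Weyl F * sl2Torus c) * sl2Upper y := by
  have hdet : s.1 0 0 * s.1 1 1 - s.1 0 1 * s.1 1 0 = 1 := by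
    rw [← det_fin_two]; exact s.2
  by_cases hc : s.1 1 0 = 0
  · left
    rw [hc, mul_zero, sub_zero] at hdet
    have ha : s.1 0 0 ≠ 0 := left_ne_zero_of_mul_eq_one hdet
    refine ⟨Units.mk0 _ ha, s.1 0 1 / s.1 0 0, ?_⟩
    have hd : s.1 1 1 = (s.1 0 0)⁻¹ := eq_inv_of_mul_eq_one_right hdet
    ext i j; fin_cases i <;> fin_cases j <;>
      simp [coe_sl2Upper, coe_sl2Torus, hc, hd]
    field_simp
  · right
    refine ⟨s.1 0 0 / s.1 1 0, Units.mk0 _ hc, s.1 1 1 / s.1 1 0, ?_⟩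
    ext i j; fin_cases i <;> fin_cases j <;>
      simp [coe_sl2Upper, coe_sl2Torus, coe_sl2Weyl] <;> field_simp
    linear_combination -hdet

/-- A subset of a `SL₂`-set is closed under the action as soon as it is closed under unipotents,
the torus and the Weyl element. -/
lemma sl2_induction {P : SpecialLinearGroup (Fin 2) F → Prop}
    (mul : ∀ s s', P s → P s' → P (s * s')) (upper : ∀ x, P (sl2Upper x))
    (torus : ∀ a, P (sl2Torus a)) (weyl : P (sl2Weyl F)) (s) : P s := by
  rcases sl2_bruhat s with ⟨a, x, rfl⟩ | ⟨x, c, y, rfl⟩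
  · exact mul _ _ (torus a) (upper x)
  · exact mul _ _ (mul _ _ (upper x) (mul _ _ weyl (torus c))) (upper y)

end SL2Relations

/-! ### A computable model of the field of order 49 -/

/-- A model of the field with 49 elements, generated over the prime field by an element `t` with
`t ^ 2 = 1 - t`. -/
abbrev QuadSeven : Type := QuadraticAlgebra (ZMod 7) 1 (-1)

namespace QuadSeven

instance : Fintype QuadSeven :=
  Fintype.ofEquiv (ZMod 7 × ZMod 7) (QuadraticAlgebra.equivProd 1 (-1)).symm

lemma exists_mul_eq_one : ∀ x : QuadSeven, x ≠ 0 → ∃ y, x * y = 1 := by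
  decide +kernel

/-- The nonsquare $3+t$ is chosen because it equals $4-t^2$, the factor by which the Weyl element
alters the lower-left entry of a matrix of trace $t$. -/
lemma eq_sq_or_mul_sq : ∀ x : QuadSeven, ∃ a, x = a ^ 2 ∨ x = ⟨3, 1⟩ * a ^ 2 := by
  decide +kernel

lemma eq_sq_or_omega_mul_sq : ∀ x : QuadSeven, ∃ a, x = a ^ 2 ∨ x = ⟨0, 1⟩ * a ^ 2 := by
  decide +kernel

/-- Any field of order 49 is isomorphic to the model, with the generator going to any given root
of `X ^ 2 + X - 1`. -/
lemma exists_equiv {F : Type*} [Field F] (hF : Nat.card F = 49) {t : F} (ht : t ^ 2 = 1 - t) :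
    ∃ φ : QuadSeven ≃+* F, φ ⟨0, 1⟩ = t := by
  have : Finite F := Nat.finite_of_card_ne_zero (by omega)
  have := Fintype.ofFinite F
  have : CharP F 7 := by
    obtain ⟨p, hp⟩ := CharP.exists F
    obtain ⟨n, hpr, hn⟩ := FiniteField.card F p
    rw [← Nat.card_eq_fintype_card, hF] at hn
    have : p ∣ 7 ^ 2 := by
      rw [show 7 ^ 2 = 49 by norm_num, hn]; exact dvd_pow_self _ n.ne_zero
    rwa [← (Nat.prime_dvd_prime_iff_eq hpr (by norm_num)).mp (hpr.dvd_of_dvd_pow this)]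
  let _ : Algebra (ZMod 7) F := ZMod.algebra F 7
  let φ : QuadSeven →+* F := (QuadraticAlgebra.lift (R := ZMod 7) (a := 1) (b := -1)
    ⟨t, by rw [← sq, ht]; simp [Algebra.smul_def, sub_eq_add_neg]⟩).toRingHom
  have hinj : Function.Injective φ := by
    rw [injective_iff_map_eq_zero]
    intro x hx
    by_contra h
    obtain ⟨y, hy⟩ := exists_mul_eq_one x h
    simpa [hx] using congrArg φ hy
  have hbij : Function.Bijective φ := by
    rw [Fintype.bijective_iff_injective_and_card]
    refine ⟨hinj, ?_⟩
    rw [← Nat.card_eq_fintype_card (α := F), hF]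
    decide +kernel
  refine ⟨RingEquiv.ofBijective φ hbij, ?_⟩
  change (0 : ZMod 7) • (1 : F) + (1 : ZMod 7) • t = t
  simp

end QuadSeven

/-! ### Elements of order five and the pentagon relations -/

open Matrix in
/-- A homomorphism from `SL₂` to a ring that is trivial on `-1` and for which the sum over every
cyclic subgroup of order five generated by an element of trace `t` vanishes. Up to conjugation by
unipotents the generators are `u(y) w h(c) u(y)`. -/
structure IsPentagonal {F A : Type*} [Field F] [Ring A] (ρ : SpecialLinearGroup (Fin 2) F →* A)
    (t : Fˣ) : Prop where
  map_neg_one : ρ (-1) = 1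
  relation (c : Fˣ) (y z : F) (hy : 2 * c * y = t) (hz : z * t ^ 3 = y) :
    1 + ρ (sl2Upper y * (sl2Weyl F * sl2Torus c) * sl2Upper y) +
      ρ (sl2Upper (-y) * (sl2Weyl F * sl2Torus c) * sl2Upper (-y)) +
      ρ (sl2Upper z * (sl2Weyl F * sl2Torus (c * t)) * sl2Upper z) +
      ρ (sl2Upper (-z) * (sl2Weyl F * sl2Torus (c * t)) * sl2Upper (-z)) = 0

section OrderFive

open Matrix

variable {F : Type*} [Field F]

lemma mul_self_of_det_eq_one {M : Matrix (Fin 2) (Fin 2) F} (hM : M.det = 1) :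
    M * M = (M 0 0 + M 1 1) • M - 1 := by
  rw [det_fin_two] at hM
  ext i j; fin_cases i <;> fin_cases j <;> simp [Matrix.mul_apply, Fin.sum_univ_two]
  · linear_combination -hM
  · ring
  · ring
  · linear_combination -hM

/-- An element of order five of `SL₂(49)` is not triangular, and its trace is a root of
`X ^ 2 + X - 1`. -/
lemma trace_of_pow_five (hF : Nat.card F = 49) {M : Matrix (Fin 2) (Fin 2) F}
    (hM : M.det = 1) (hM5 : M ^ 5 = 1) (h1 : M ≠ 1) :
    M 1 0 ≠ 0 ∧ (M 0 0 + M 1 1) ^ 2 = 1 - (M 0 0 + M 1 1) := by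
  have hfin : Finite F := Nat.finite_of_card_ne_zero (by omega)
  have := Fintype.ofFinite F
  have h49 (x : F) : x ^ 49 = x := by
    have := FiniteField.pow_card x
    rwa [← Nat.card_eq_fintype_card, hF] at this
  have h7 : (7 : F) = 0 := by
    have : ((49 : ℕ) : F) = 0 := by
      rw [← hF, Nat.card_eq_fintype_card]; exact Nat.cast_card_eq_zero F
    have : (7 : F) * 7 = 0 := by norm_num at this ⊢; exact this
    exact mul_self_eq_zero.mp this
  have hsq := mul_self_of_det_eq_one hM
  have hdet := hM
  rw [det_fin_two] at hdet
  set t := M 0 0 + M 1 1 with ht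
  -- Fifth power of $M$ by repeated use of Cayley–Hamilton $M^2=tM-1$.
  have hexp : (t ^ 4 - 3 * t ^ 2 + 1) • M -
      (t ^ 3 - 2 * t) • (1 : Matrix (Fin 2) (Fin 2) F) = 1 := by
    have e2 : M ^ 2 = t • M - 1 := by rw [sq]; exact hsq
    have e3 : M ^ 3 = (t ^ 2 - 1) • M - t • 1 := by
      rw [pow_succ, e2, sub_mul, smul_mul_assoc, hsq, one_mul]; module
    have e4 : M ^ 4 = (t ^ 3 - 2 * t) • M - (t ^ 2 - 1) • 1 := by
      rw [pow_succ, e3, sub_mul, smul_mul_assoc, smul_mul_assoc, hsq, one_mul]; module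
    have e5 : M ^ 5 = (t ^ 4 - 3 * t ^ 2 + 1) • M - (t ^ 3 - 2 * t) • 1 := by
      rw [pow_succ, e4, sub_mul, smul_mul_assoc, smul_mul_assoc, hsq, one_mul]; module
    rw [← e5, hM5]
  have hc : M 1 0 ≠ 0 := by
    intro hc
    apply h1
    rw [hc, mul_zero, sub_zero] at hdet
    have e00 := congrFun (congrFun hM5 0) 0
    have hmul : ∀ n : ℕ, (M ^ n) 0 0 = M 0 0 ^ n ∧ (M ^ n) 1 0 = 0 := by
      intro n
      induction n with
      | zero => simp
      | succ n ih => simp [pow_succ, Matrix.mul_apply, Fin.sum_univ_two, ih.1, ih.2, hc]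
    rw [(hmul 5).1, one_apply_eq] at e00
    -- 5 is prime to 48, so a triangular $M$ has diagonal 1; then it is unipotent and its fifth
    -- power is trivial only for $M=1$.
    have ha : M 0 0 = 1 := by
      have h := h49 (M 0 0)
      have h4 : M 0 0 ^ 4 = M 0 0 := by
        rw [← h, ← pow_mul]
        calc M 0 0 ^ (49 * 4) = (M 0 0 ^ 5) ^ 39 * M 0 0 := by ring
          _ = M 0 0 ^ 49 := by rw [e00, one_pow, one_mul, h]
      have h2 : M 0 0 ^ 2 = 1 := by
        rw [← e00, pow_succ _ 4, h4, sq]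
      calc M 0 0 = M 0 0 ^ 4 := h4.symm
        _ = (M 0 0 ^ 2) ^ 2 := by ring
        _ = 1 := by rw [h2, one_pow]
    have hd : M 1 1 = 1 := by rw [ha, one_mul] at hdet; exact hdet
    have ht2 : t = 2 := by rw [ht, ha, hd]; norm_num
    have hb := congrFun (congrFun hexp 0) 1
    simp [ht2] at hb
    have hb0 : M 0 1 = 0 := by
      have h5' : (2 ^ 4 - 3 * 2 ^ 2 + 1 : F) ≠ 0 := by
        intro h
        have : (1 : F) = 0 := by linear_combination 3 * h - 2 * h7
        exact one_ne_zero this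
      exact hb.resolve_left h5'
    ext i j; fin_cases i <;> fin_cases j <;> simp [ha, hb0, hc, hd]
  refine ⟨hc, ?_⟩
  have h10 := congrFun (congrFun hexp 1) 0
  have h00 := congrFun (congrFun hexp 0) 0
  simp at h10 h00
  replace h10 := h10.resolve_right hc
  rw [h10, zero_mul] at h00
  -- The second factor would give $M^5=-1$, that is, elements of order ten.
  have hfac : (t ^ 2 + t - 1) * (t ^ 2 - t - 1) = 0 := by linear_combination h10
  rcases mul_eq_zero.mp hfac with h | h
  · linear_combination h
  · exfalso
    have : (2 : F) = 0 := by linear_combination -h00 - (t + 1) * h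
    exact one_ne_zero (show (1 : F) = 0 by linear_combination h7 - 3 * this)

/-- The elements of trace `t` are conjugate under unipotents to `u(y) w h(c) u(y)`. -/
lemma exists_upper_conj [NeZero (2 : F)] {t : F} (s : SpecialLinearGroup (Fin 2) F)
    (hs : s 0 0 + s 1 1 = t) (c : Fˣ) (hc : s 1 0 = c) (y : F) (hy : 2 * c * y = t) :
    ∃ g, g * s * g⁻¹ = sl2Upper y * (sl2Weyl F * sl2Torus c) * sl2Upper y := by
  have h2 : (2 : F) ≠ 0 := NeZero.ne _
  have hc0 : (c : F) ≠ 0 := c.ne_zero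
  have hdet : s 0 0 * s 1 1 - s 0 1 * s 1 0 = 1 := by
    rw [← det_fin_two]; exact s.2
  -- This unipotent makes the two diagonal entries equal, and $u(y)wh(c)u(y)$ is the matrix with
  -- both diagonal entries $cy=t/2$ and lower-left entry $c$.
  refine ⟨sl2Upper ((s 1 1 - s 0 0) / (2 * c)), ?_⟩
  rw [mul_inv_eq_iff_eq_mul]
  have hy' : y = t / (2 * c) := by field_simp; linear_combination hy
  have hb : s 0 1 = (s 0 0 * s 1 1 - 1) / c := by
    field_simp; rw [← hc]; linear_combination -hdet
  ext i j; fin_cases i <;> fin_cases j <;>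
    simp [coe_sl2Upper, coe_sl2Torus, coe_sl2Weyl, Matrix.mul_apply, Fin.sum_univ_two,
      -cons_mul, hc, hy', ← hs, hb] <;> field_simp <;> ring

/-- If the elements of one subgroup of order five sum to zero under `ρ`, then `ρ` is pentagonal. -/
lemma IsPentagonal.of_sum_eq_zero {A : Type*} [Ring A] (hF : Nat.card F = 49)
    {ρ : SpecialLinearGroup (Fin 2) F →* A} (hneg : ρ (-1) = 1)
    (s : SpecialLinearGroup (Fin 2) F) (h5 : s ^ 5 = 1) {t : Fˣ} (hs : s 0 0 + s 1 1 = t)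
    (ht : (t : F) ^ 2 = 1 - t) (h10 : s 1 0 ≠ 0) (hsum : ∑ k ∈ Finset.range 5, ρ (s ^ k) = 0) :
    IsPentagonal ρ t := by
  obtain ⟨φ, hφ⟩ := QuadSeven.exists_equiv hF ht
  have h7 : (7 : F) = 0 := by
    have : (7 : QuadSeven) = 0 := by decide +kernel
    rw [← map_ofNat φ 7, this, map_zero]
  have h2 : NeZero (2 : F) := ⟨fun h => one_ne_zero (show (1 : F) = 0 by
    linear_combination h7 - 3 * h)⟩
  have h2' : (2 : F) ≠ 0 := h2.ne
  have ht0 : (t : F) ≠ 0 := t.ne_zero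
  have hconj (g : SpecialLinearGroup (Fin 2) F) :
      ∑ k ∈ Finset.range 5, ρ ((g * s * g⁻¹) ^ k) = 0 := by
    simp_rw [conj_pow, map_mul, ← Finset.sum_mul, ← Finset.mul_sum]
    rw [hsum, mul_zero, zero_mul]
  refine ⟨hneg, fun c y z hy hz => ?_⟩
  -- every element `u(y) w h(c) u(y)` is conjugate to `s`
  obtain ⟨g, hg⟩ : ∃ g, g * s * g⁻¹ = sl2Upper y * (sl2Weyl F * sl2Torus c) * sl2Upper y := by
    set c₀ : Fˣ := Units.mk0 _ h10 with hc₀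
    -- Torus conjugation changes the lower-left entry by an arbitrary square.
    have key (s' : SpecialLinearGroup (Fin 2) F) (hs' : s' 0 0 + s' 1 1 = t) (a : Fˣ)
        (ha : s' 1 0 = c * a ^ 2) :
        ∃ g, g * s' * g⁻¹ = sl2Upper y * (sl2Weyl F * sl2Torus c) * sl2Upper y := by
      have htr : (sl2Torus a * s' * (sl2Torus a)⁻¹) 0 0 +
          (sl2Torus a * s' * (sl2Torus a)⁻¹) 1 1 = t := by
        rw [← hs', ← map_inv]
        simp [coe_sl2Torus, -cons_mul, Matrix.mul_apply, Fin.sum_univ_two]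
        field_simp
      have hlow : (sl2Torus a * s' * (sl2Torus a)⁻¹) 1 0 = c := by
        rw [← map_inv]
        simp [coe_sl2Torus, -cons_mul, Matrix.mul_apply, Fin.sum_univ_two, ha]
        field_simp
      obtain ⟨g, hg⟩ := exists_upper_conj _ htr c hlow y hy
      exact ⟨g * sl2Torus a, by rw [← hg]; group⟩
    obtain ⟨x, hx⟩ := φ.surjective (c₀ / c)
    obtain ⟨a, ha⟩ := QuadSeven.eq_sq_or_mul_sq x
    have hφ3 : φ ⟨3, 1⟩ = 3 + t := by
      have : (⟨3, 1⟩ : QuadSeven) = 3 + ⟨0, 1⟩ := by decide +kernel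
      rw [this, map_add, hφ, map_ofNat]
    have hc₀' : (c₀ : F) ≠ 0 := c₀.ne_zero
    have hc' : (c : F) ≠ 0 := c.ne_zero
    have ha0 : φ a ≠ 0 := by
      intro h
      have : (c₀ : F) / c = 0 := by
        rw [← hx]; rcases ha with ha | ha <;> rw [ha] <;> simp [h]
      exact div_ne_zero hc₀' hc' this
    rcases ha with ha | ha
    · refine key s hs (Units.mk0 _ ha0) ?_
      change (c₀ : F) = c * φ a ^ 2
      rw [← map_pow, ← ha, hx]; field_simp
    · have h3 : (3 + t : F) * φ a ^ 2 = c₀ / c := by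
        rw [← hx, ha, map_mul, hφ3, map_pow]
      have h30 : (3 + t : F) ≠ 0 := by
        intro h
        rw [h, zero_mul] at h3
        exact div_ne_zero hc₀' hc' h3.symm
      -- The wrong square class is repaired by $w$: after equalising the diagonal, conjugation by
      -- $w$ turns $c_0$ into $(4-t^2)/(4c_0)=(3+t)/(4c_0)$.
      obtain ⟨g₀, hg₀⟩ := exists_upper_conj s hs c₀ rfl (t / (2 * c₀)) (by field_simp)
      have htr : (sl2Weyl F * (g₀ * s * g₀⁻¹) * (sl2Weyl F)⁻¹) 0 0 +
          (sl2Weyl F * (g₀ * s * g₀⁻¹) * (sl2Weyl F)⁻¹) 1 1 = t := by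
        rw [hg₀]
        simp [coe_sl2Torus, coe_sl2Upper, coe_sl2Weyl, adjugate_fin_two]
        field_simp; ring
      obtain ⟨b, hb⟩ : ∃ b : Fˣ, (b : F) = (3 + t) * φ a / (2 * c₀) :=
        ⟨Units.mk0 _ (div_ne_zero (mul_ne_zero h30 ha0) (mul_ne_zero h2' hc₀')), rfl⟩
      have hlow : (sl2Weyl F * (g₀ * s * g₀⁻¹) * (sl2Weyl F)⁻¹) 1 0 = c * b ^ 2 := by
        rw [hg₀, hb]
        field_simp at h3
        simp [coe_sl2Torus, coe_sl2Upper, coe_sl2Weyl, adjugate_fin_two]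
        field_simp
        linear_combination -(3 + t : F) * h3 - (c₀ : F) * ht
      obtain ⟨g, hg⟩ := key _ htr _ hlow
      exact ⟨g * sl2Weyl F * g₀, by rw [← hg]; group⟩
  have hσ5 : (sl2Upper y * (sl2Weyl F * sl2Torus c) * sl2Upper y) ^ 5 = 1 := by
    rw [← hg, conj_pow, h5, mul_one, mul_inv_cancel]
  have hσ := hconj g
  rw [hg] at hσ
  have hc0 : (c : F) ≠ 0 := c.ne_zero
  have hy' : y = t / (2 * c) := by field_simp; linear_combination hy
  have hz' : z = 1 / (2 * c * t ^ 2) := by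
    field_simp
    have := hz.trans hy'
    field_simp at this
    linear_combination this
  -- With $\sigma=u(y)wh(c)u(y)$, the elements in the relation are $\sigma$, $-\sigma^{-1}$,
  -- $-\sigma^{-2}$ and $\sigma^2$; the signs are invisible to $\rho$.
  have e1 : sl2Upper y * (sl2Weyl F * sl2Torus c) * sl2Upper y *
      (sl2Upper (-y) * (sl2Weyl F * sl2Torus c) * sl2Upper (-y)) = -1 := by
    ext i j; fin_cases i <;> fin_cases j <;>
      simp [coe_sl2Upper, coe_sl2Torus, coe_sl2Weyl, hy'] <;> field_simp <;> ring
  have e2 : (sl2Upper y * (sl2Weyl F * sl2Torus c) * sl2Upper y) ^ 2 =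
      sl2Upper (-z) * (sl2Weyl F * sl2Torus (c * t)) * sl2Upper (-z) := by
    rw [sq]
    ext i j; fin_cases i <;> fin_cases j <;>
      simp [coe_sl2Upper, coe_sl2Torus, coe_sl2Weyl, hy', hz'] <;> field_simp
    · linear_combination (2 * (t : F) - 2) * ht
    · linear_combination 2 * ((t : F) ^ 2 - 1) * ((t : F) ^ 2 - t - 1) * ht
    · norm_num
    · linear_combination (2 * (t : F) - 2) * ht
  have e3 : sl2Upper (-z) * (sl2Weyl F * sl2Torus (c * t)) * sl2Upper (-z) *
      (sl2Upper z * (sl2Weyl F * sl2Torus (c * t)) * sl2Upper z) = -1 := by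
    ext i j; fin_cases i <;> fin_cases j <;>
      simp [coe_sl2Upper, coe_sl2Torus, coe_sl2Weyl, hz'] <;> field_simp <;> ring
  set σ := sl2Upper y * (sl2Weyl F * sl2Torus c) * sl2Upper y
  set σ' := sl2Upper (-z) * (sl2Weyl F * sl2Torus (c * t)) * sl2Upper (-z)
  have hpow {τ τ' : SpecialLinearGroup (Fin 2) F} {m n : ℕ} (hmn : m + n = 5) (hm : σ ^ m = τ)
      (h : τ * τ' = -1) : ρ (σ ^ n) = ρ τ' := by
    have : σ ^ n = -1 * τ' := by
      rw [← mul_right_inj τ, neg_one_mul, mul_neg, h, neg_neg, ← hm, ← pow_add, hmn, hσ5]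
    rw [this, map_mul, hneg, one_mul]
  have e4 := hpow (m := 1) (n := 4) rfl (pow_one σ) e1
  have e5 := hpow (m := 2) (n := 3) rfl e2 e3
  rw [Finset.sum_range_succ, Finset.sum_range_succ, Finset.sum_range_succ, Finset.sum_range_succ,
    Finset.sum_range_one, pow_zero, map_one, pow_one, e2, e4, e5] at hσ
  rw [← hσ]; abel

end OrderFive

/-! ### A finite check used for the nonvanishing determinant -/

namespace QuadSeven

/-- Here $a_i,a_i'$ are torus parameters and their inverses, and `⟨3, 2⟩` is $3+2t=t^{-3}$, the
ratio $z/y$ in the pentagon relation. The negated clause is exactly what a vanishing $2\times2$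
determinant of character sums would contradict. -/
lemma exists_separating_pair (s s' : QuadSeven) (hs' : s' = 1 ∨ s' = ⟨0, 1⟩) :
    ∃ a₁ a₁' a₂ a₂' : QuadSeven, a₁ * a₁' = 1 ∧ a₂ * a₂' = 1 ∧
      s * a₁' ^ 2 ≠ s' * a₁ ^ 2 ∧ s * a₂' ^ 2 ≠ s' * a₂ ^ 2 ∧
      ∃ n₁ m₁ n₂ m₂ : ZMod 7, n₁ = (s * a₁' ^ 2 + s' * a₁ ^ 2).re ∧
        m₁ = (⟨3, 2⟩ * (s * a₁' ^ 2 + s' * a₁ ^ 2) : QuadSeven).re ∧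
        n₂ = (s * a₂' ^ 2 + s' * a₂ ^ 2).re ∧
        m₂ = (⟨3, 2⟩ * (s * a₂' ^ 2 + s' * a₂ ^ 2) : QuadSeven).re ∧
        ¬(((n₁ + m₂) ^ 2 = (n₂ + m₁) ^ 2 ↔ (n₁ - m₂) ^ 2 = (n₂ - m₁) ^ 2) ∧
          ((n₁ + m₂) ^ 2 = (n₂ - m₁) ^ 2 ↔ (n₁ - m₂) ^ 2 = (n₂ + m₁) ^ 2)) := by
  -- Four fixed choices of parameters serve for all $s$ and both $s'$.
  have key : ∀ s s' : QuadSeven, s' = 1 ∨ s' = ⟨0, 1⟩ →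
    ∃ w ∈ ([(⟨1, 0⟩, ⟨1, 0⟩, ⟨3, 0⟩, ⟨5, 0⟩),
      (⟨2, 2⟩, ⟨0, 4⟩, ⟨3, 1⟩, ⟨6, 4⟩),
      (⟨2, 2⟩, ⟨0, 4⟩, ⟨3, 6⟩, ⟨1, 2⟩),
      (⟨1, 1⟩, ⟨0, 1⟩, ⟨0, 3⟩, ⟨5, 5⟩)] : List (QuadSeven × QuadSeven × QuadSeven × QuadSeven)),
      w.1 * w.2.1 = 1 ∧ w.2.2.1 * w.2.2.2 = 1 ∧
      s * w.2.1 ^ 2 ≠ s' * w.1 ^ 2 ∧ s * w.2.2.2 ^ 2 ≠ s' * w.2.2.1 ^ 2 ∧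
      (let n₁ := (s * w.2.1 ^ 2 + s' * w.1 ^ 2).re
       let m₁ := (⟨3, 2⟩ * (s * w.2.1 ^ 2 + s' * w.1 ^ 2) : QuadSeven).re
       let n₂ := (s * w.2.2.2 ^ 2 + s' * w.2.2.1 ^ 2).re
       let m₂ := (⟨3, 2⟩ * (s * w.2.2.2 ^ 2 + s' * w.2.2.1 ^ 2) : QuadSeven).re
       ¬(((n₁ + m₂) ^ 2 = (n₂ + m₁) ^ 2 ↔ (n₁ - m₂) ^ 2 = (n₂ - m₁) ^ 2) ∧
          ((n₁ + m₂) ^ 2 = (n₂ - m₁) ^ 2 ↔ (n₁ - m₂) ^ 2 = (n₂ + m₁) ^ 2))) := by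
    decide +kernel
  obtain ⟨w, -, h1, h2, h3, h4, h5⟩ := key s s' hs'
  exact ⟨_, _, _, _, h1, h2, h3, h4, _, _, _, _, rfl, rfl, rfl, rfl, h5⟩

end QuadSeven

/-! ### Characters of the unipotent group -/

section Characters

open Matrix

/-- $\chi(a)$ and $\chi(-a)$ have product 1, so their sum determines them as the roots of a
quadratic. -/
lemma AddChar.add_apply_neg_eq_iff {K : Type*} [Field K] {χ : AddChar (ZMod 7) K}
    (hχ : Function.Injective χ) {a b : ZMod 7} : χ a + χ (-a) = χ b + χ (-b) ↔ a ^ 2 = b ^ 2 := by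
  have : Fact (Nat.Prime 7) := ⟨by norm_num⟩
  rw [sq_eq_sq_iff_eq_or_eq_neg]
  constructor
  · intro h
    have ha : χ a * χ (-a) = 1 := by rw [← AddChar.map_add_eq_mul]; simp
    have hb : χ b * χ (-b) = 1 := by rw [← AddChar.map_add_eq_mul]; simp
    have : (χ a - χ b) * (χ a - χ (-b)) = 0 := by
      linear_combination χ a * h - ha + hb
    rcases mul_eq_zero.mp this with h | h
    · exact Or.inl (hχ (sub_eq_zero.mp h))
    · exact Or.inr (hχ (sub_eq_zero.mp h))
  · rintro (rfl | rfl)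
    · rfl
    · rw [neg_neg, add_comm]

variable {F K A : Type*} [Field F] [Fintype F] [Field K] [Ring A] [Algebra K A]

/-- The multiple by `|F|` of the idempotent of the unipotent group of `SL₂` that belongs to the
character `x ↦ ψ (s * x)`. -/
def unipotentSum (ρ : SpecialLinearGroup (Fin 2) F →* A) (ψ : AddChar F K) (s : F) : A :=
  ∑ x, ψ (-(s * x)) • ρ (sl2Upper x)

variable (ρ : SpecialLinearGroup (Fin 2) F →* A) (ψ : AddChar F K)

lemma map_upper_mul_unipotentSum (s x : F) :
    ρ (sl2Upper x) * unipotentSum ρ ψ s = ψ (s * x) • unipotentSum ρ ψ s := by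
  rw [unipotentSum, Finset.mul_sum, Finset.smul_sum]
  refine Fintype.sum_equiv (Equiv.addLeft x) _ _ fun y => ?_
  rw [Equiv.coe_addLeft, mul_smul_comm, ← map_mul, ← sl2Upper_add, smul_smul,
    ← AddChar.map_add_eq_mul]
  congr 2
  ring

lemma unipotentSum_mul_map_upper (s x : F) :
    unipotentSum ρ ψ s * ρ (sl2Upper x) = ψ (s * x) • unipotentSum ρ ψ s := by
  rw [← map_upper_mul_unipotentSum, unipotentSum, Finset.mul_sum, Finset.sum_mul]
  refine Finset.sum_congr rfl fun y _ => ?_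
  rw [mul_smul_comm, smul_mul_assoc, ← map_mul, ← map_mul, ← sl2Upper_add, ← sl2Upper_add,
    add_comm]

lemma unipotentSum_mul_unipotentSum (hψ : ψ.IsPrimitive) {s s' : F} (h : s ≠ s') :
    unipotentSum ρ ψ s * unipotentSum ρ ψ s' = 0 := by
  have key (x : F) : (ψ (s * x) - ψ (s' * x)) • (unipotentSum ρ ψ s * unipotentSum ρ ψ s') = 0 := by
    rw [sub_smul, ← smul_mul_assoc, ← unipotentSum_mul_map_upper, ← mul_smul_comm,
      ← map_upper_mul_unipotentSum, mul_assoc, sub_self]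
  by_contra h0
  apply h
  have : ∀ x, ψ (s * x) = ψ (s' * x) := fun x =>
    sub_eq_zero.mp ((smul_eq_zero.mp (key x)).resolve_right h0)
  exact AddChar.to_mulShift_inj_of_isPrimitive hψ (by ext x; simpa using this x)

/-- Orthogonality of characters: after exchanging the sums only $x=0$ survives. -/
lemma sum_unipotentSum [DecidableEq F] (hψ : ψ.IsPrimitive) :
    ∑ s, unipotentSum ρ ψ s = (Fintype.card F : K) • (1 : A) := by
  simp_rw [unipotentSum]
  rw [Finset.sum_comm]
  simp_rw [← Finset.sum_smul, ← mul_neg]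
  simp_rw [AddChar.sum_mulShift _ hψ, neg_eq_zero]
  simp [ite_smul, sl2Upper_zero]

lemma map_torus_mul_unipotentSum (a : Fˣ) (s : F) :
    ρ (sl2Torus a) * unipotentSum ρ ψ s =
      unipotentSum ρ ψ (s * ((a⁻¹ : Fˣ) : F) ^ 2) * ρ (sl2Torus a) := by
  rw [unipotentSum, unipotentSum, Finset.mul_sum, Finset.sum_mul]
  refine Fintype.sum_equiv (Units.mulLeft (a ^ 2)) _ _ fun x => ?_
  rw [mul_smul_comm, ← map_mul, sl2Torus_mul_upper, smul_mul_assoc, map_mul]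
  simp only [Units.mulLeft_apply, Units.val_pow_eq_pow_val]
  congr 3
  simp; field_simp

end Characters

/-! ### Characteristics other than 5 and 7 -/

section NonDefining

open Matrix

variable {F K A : Type*} [Field F] [Fintype F] [Field K] [Ring A] [Algebra K A]
  {ρ : SpecialLinearGroup (Fin 2) F →* A} {t : Fˣ}

/-- The pentagon relation between two distinct eigenspaces of the unipotent group. -/
lemma IsPentagonal.unipotentSum_relation (h : IsPentagonal ρ t) {ψ : AddChar F K}
    (hψ : ψ.IsPrimitive) {s s' : F} (hs : s ≠ s') (c : Fˣ) {y z : F} (hy : 2 * c * y = t)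
    (hz : z * t ^ 3 = y) :
    (ψ ((s + s') * y) + ψ (-((s + s') * y))) •
        (unipotentSum ρ ψ s * ρ (sl2Weyl F * sl2Torus c) * unipotentSum ρ ψ s') +
      (ψ ((s + s') * z) + ψ (-((s + s') * z))) •
        (unipotentSum ρ ψ s * ρ (sl2Weyl F * sl2Torus (c * t)) * unipotentSum ρ ψ s') = 0 := by
  have key (x : F) (g) : unipotentSum ρ ψ s * ρ (sl2Upper x * g * sl2Upper x) *
      unipotentSum ρ ψ s' = ψ ((s + s') * x) •
        (unipotentSum ρ ψ s * ρ g * unipotentSum ρ ψ s') := by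
    rw [map_mul, map_mul, ← mul_assoc, ← mul_assoc, unipotentSum_mul_map_upper, mul_assoc _ _
      (unipotentSum ρ ψ s'), map_upper_mul_unipotentSum, smul_mul_assoc, smul_mul_assoc,
      mul_smul_comm, smul_smul, ← AddChar.map_add_eq_mul, add_mul]
  -- Sandwiching kills the term 1 by orthogonality and turns the outer unipotents into scalars.
  have hrel := congrArg (fun a => unipotentSum ρ ψ s * a * unipotentSum ρ ψ s')
    (h.relation c y z hy hz)
  simp only [mul_add (unipotentSum ρ ψ s), add_mul _ _ (unipotentSum ρ ψ s'), key, mul_one,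
    unipotentSum_mul_unipotentSum ρ ψ hψ hs,
    mul_zero, zero_mul, zero_add] at hrel
  rw [add_smul, add_smul, ← add_assoc, ← hrel]
  simp only [mul_neg]

/-- Since $h(a)w=wh(a^{-1})$, the two torus factors cancel around $wh(c)$ while moving the two
characters in opposite directions. -/
lemma unipotentSum_torus_conj (ψ : AddChar F K) (a c : Fˣ) (s s' : F) :
    ρ (sl2Torus a) * (unipotentSum ρ ψ s * ρ (sl2Weyl F * sl2Torus c) * unipotentSum ρ ψ s') *
        ρ (sl2Torus a) =
      unipotentSum ρ ψ (s * ((a⁻¹ : Fˣ) : F) ^ 2) * ρ (sl2Weyl F * sl2Torus c) *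
        unipotentSum ρ ψ (s' * (a : F) ^ 2) := by
  have h1 : unipotentSum ρ ψ s' * ρ (sl2Torus a) =
      ρ (sl2Torus a) * unipotentSum ρ ψ (s' * (a : F) ^ 2) := by
    rw [map_torus_mul_unipotentSum, mul_assoc s', ← mul_pow, Units.mul_inv, one_pow, mul_one]
  have h2 : ρ (sl2Torus a) * ρ (sl2Weyl F * sl2Torus c) * ρ (sl2Torus a) =
      ρ (sl2Weyl F * sl2Torus c) := by
    rw [← map_mul, ← map_mul, ← mul_assoc, show sl2Torus a * sl2Weyl F =
      sl2Weyl F * sl2Torus a⁻¹ by rw [sl2Weyl_mul_torus, inv_inv], mul_assoc, mul_assoc,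
      ← map_mul, ← map_mul, mul_comm c, inv_mul_cancel_left]
  rw [mul_assoc, mul_assoc, mul_assoc, h1, ← mul_assoc, map_torus_mul_unipotentSum]
  rw [mul_assoc, ← mul_assoc (ρ (sl2Torus a)), ← mul_assoc (_ * _) (ρ (sl2Torus a)), h2, mul_assoc]

/-- A pentagonal homomorphism to a nontrivial algebra only exists in characteristics 5 and 7. -/
lemma IsPentagonal.one_eq_zero (hF : Nat.card F = 49) (ht : (t : F) ^ 2 = 1 - t)
    (h : IsPentagonal ρ t) {ζ : K} (hζ : IsPrimitiveRoot ζ 7) (h5 : (5 : K) ≠ 0)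
    (h7 : (7 : K) ≠ 0) : (1 : A) = 0 := by
  classical
  obtain ⟨φ, hφ⟩ := QuadSeven.exists_equiv hF ht
  have hcard : Fintype.card F = 49 := by rw [← Nat.card_eq_fintype_card, hF]
  have h49 : ((Fintype.card F : ℕ) : K) ≠ 0 := by
    rw [hcard, show ((49 : ℕ) : K) = 7 * 7 by norm_num]; exact mul_ne_zero h7 h7
  have h7F : (7 : F) = 0 := by
    have : (7 : QuadSeven) = 0 := by decide +kernel
    rw [← map_ofNat φ 7, this, map_zero]
  have h2F : (2 : F) ≠ 0 := fun h => one_ne_zero (show (1 : F) = 0 by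
    linear_combination h7F - 3 * h)
  have ht0 : (t : F) ≠ 0 := t.ne_zero
  -- the additive characters
  let χ : AddChar (ZMod 7) K := AddChar.zmodChar 7 hζ.pow_eq_one
  have hχ : Function.Injective χ := by
    intro a b hab
    have := hζ.pow_inj (ZMod.val_lt a) (ZMod.val_lt b)
      (by simpa [χ, AddChar.zmodChar_apply] using hab)
    exact ZMod.val_injective 7 this
  let L : F →+ ZMod 7 :=
    { toFun := fun x => (φ.symm x).re, map_zero' := by simp, map_add' := fun x y => by simp }
  let ψ : AddChar F K := χ.compAddMonoidHom L
  have hψφ (x : F) : ψ x = χ (φ.symm x).re := rfl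
  have hψ : ψ.IsPrimitive := by
    intro a ha h1
    have := DFunLike.congr_fun h1 a⁻¹
    rw [AddChar.mulShift_apply, mul_inv_cancel₀ ha, AddChar.one_apply, hψφ, map_one,
      ← AddChar.map_zero_eq_one χ] at this
    exact absurd (hχ this) (by decide +kernel)
  have hμ : φ ⟨3, 2⟩ * t ^ 3 = 1 := by
    rw [← hφ, ← map_pow, ← map_mul]
    have : (⟨3, 2⟩ * ⟨0, 1⟩ ^ 3 : QuadSeven) = 1 := by decide +kernel
    rw [this, map_one]
  have hvanish (s s' : F) (hs' : s' ≠ 0) (c : Fˣ) :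
      unipotentSum ρ ψ s * ρ (sl2Weyl F * sl2Torus c) * unipotentSum ρ ψ s' = 0 := by
    set y : F := t / (2 * c) with hy
    have hc0 : (c : F) ≠ 0 := c.ne_zero
    have hy0 : y ≠ 0 := div_ne_zero ht0 (mul_ne_zero h2F hc0)
    have hyc : 2 * c * y = t := by rw [hy]; field_simp
    set z : F := φ ⟨3, 2⟩ * y with hz
    have hzt : z * t ^ 3 = y := by rw [hz]; linear_combination y * hμ
    clear_value y z
    -- The torus replaces $(s,s')$ by $(sb^{-2},s'b^2)$, so $s'y$ matters only modulo squares. The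
    -- case $s=s'$ is included, because $b$ will be chosen so that the moved characters differ.
    obtain ⟨d, σ', hσ', hd⟩ : ∃ d : F, ∃ σ' : QuadSeven, (σ' = 1 ∨ σ' = ⟨0, 1⟩) ∧
        s' * y = φ σ' * d ^ 2 := by
      obtain ⟨d, hd⟩ := QuadSeven.eq_sq_or_omega_mul_sq (φ.symm (s' * y))
      rcases hd with hd | hd
      · exact ⟨φ d, 1, Or.inl rfl, by rw [map_one, one_mul, ← map_pow, ← hd, φ.apply_symm_apply]⟩
      · exact ⟨φ d, _, Or.inr rfl, by rw [← map_pow, ← map_mul, ← hd, φ.apply_symm_apply]⟩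
    have hd0 : d ≠ 0 := by
      rintro rfl
      exact mul_ne_zero hs' hy0 (by simpa using hd)
    obtain ⟨σ, hσ⟩ : ∃ σ, φ σ = s * y * d ^ 2 := φ.surjective _
    obtain ⟨a₁, a₁', a₂, a₂', ha₁, ha₂, hne₁, hne₂, n₁, m₁, n₂, m₂, hn₁, hm₁, hn₂, hm₂, hsep⟩ :=
      QuadSeven.exists_separating_pair σ σ' hσ'
    have key (a a' : QuadSeven) (haa : a * a' = 1) (hne : σ * a' ^ 2 ≠ σ' * a ^ 2) (n m : ZMod 7)
        (hn : n = (σ * a' ^ 2 + σ' * a ^ 2).re)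
        (hm : m = (⟨3, 2⟩ * (σ * a' ^ 2 + σ' * a ^ 2) : QuadSeven).re) :
        (χ n + χ (-n)) •
            (unipotentSum ρ ψ s * ρ (sl2Weyl F * sl2Torus c) * unipotentSum ρ ψ s') +
          (χ m + χ (-m)) •
            (unipotentSum ρ ψ s * ρ (sl2Weyl F * sl2Torus (c * t)) * unipotentSum ρ ψ s') = 0 := by
      have hφa : φ a * φ a' = 1 := by rw [← map_mul, haa, map_one]
      have hφa0 : φ a ≠ 0 := left_ne_zero_of_mul_eq_one hφa
      have hφa' : φ a' = (φ a)⁻¹ := eq_inv_of_mul_eq_one_right hφa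
      obtain ⟨b, hb⟩ : ∃ b : Fˣ, (b : F) = φ a / d := ⟨Units.mk0 _ (div_ne_zero hφa0 hd0), rfl⟩
      have e1 : s * ((b⁻¹ : Fˣ) : F) ^ 2 * y = φ (σ * a' ^ 2) := by
        rw [map_mul, hσ, map_pow, hφa', Units.val_inv_eq_inv_val, hb]; field_simp
      have e2 : s' * (b : F) ^ 2 * y = φ (σ' * a ^ 2) := by
        rw [map_mul, map_pow, hb]; field_simp; linear_combination hd
      have hne' : s * ((b⁻¹ : Fˣ) : F) ^ 2 ≠ s' * (b : F) ^ 2 := by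
        intro heq
        exact hne (φ.injective (by rw [← e1, ← e2, heq]))
      have hrel := h.unipotentSum_relation hψ hne' c hyc hzt
      have e3 : ψ ((s * ((b⁻¹ : Fˣ) : F) ^ 2 + s' * (b : F) ^ 2) * y) = χ n ∧
          ψ (-((s * ((b⁻¹ : Fˣ) : F) ^ 2 + s' * (b : F) ^ 2) * y)) = χ (-n) := by
        rw [add_mul, e1, e2, ← map_add, hψφ, hψφ, ← map_neg, φ.symm_apply_apply,
          φ.symm_apply_apply, hn, QuadraticAlgebra.re_neg]
        exact ⟨rfl, rfl⟩
      have e4 : ψ ((s * ((b⁻¹ : Fˣ) : F) ^ 2 + s' * (b : F) ^ 2) * z) = χ m ∧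
          ψ (-((s * ((b⁻¹ : Fˣ) : F) ^ 2 + s' * (b : F) ^ 2) * z)) = χ (-m) := by
        rw [hz, mul_left_comm, add_mul, e1, e2, ← map_add, ← map_mul, hψφ, hψφ, ← map_neg,
          φ.symm_apply_apply, φ.symm_apply_apply, hm, QuadraticAlgebra.re_neg]
        exact ⟨rfl, rfl⟩
      rw [e3.1, e3.2, e4.1, e4.2, ← unipotentSum_torus_conj, ← unipotentSum_torus_conj]
        at hrel
      set J := unipotentSum ρ ψ s * ρ (sl2Weyl F * sl2Torus c) * unipotentSum ρ ψ s'
      set J' := unipotentSum ρ ψ s * ρ (sl2Weyl F * sl2Torus (c * t)) * unipotentSum ρ ψ s'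
      replace hrel : ρ (sl2Torus b) * ((χ n + χ (-n)) • J + (χ m + χ (-m)) • J') *
          ρ (sl2Torus b) = 0 := by
        simpa only [mul_add (ρ (sl2Torus b)), add_mul _ _ (ρ (sl2Torus b)), mul_smul_comm,
          smul_mul_assoc] using hrel
      have hinv : ρ (sl2Torus b⁻¹) * ρ (sl2Torus b) = 1 := by
        rw [← map_mul, ← map_mul, inv_mul_cancel, map_one, map_one]
      have hinv' : ρ (sl2Torus b) * ρ (sl2Torus b⁻¹) = 1 := by
        rw [← map_mul, ← map_mul, mul_inv_cancel, map_one, map_one]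
      have := congrArg (fun x => ρ (sl2Torus b⁻¹) * x * ρ (sl2Torus b⁻¹)) hrel
      simpa only [mul_assoc, hinv', mul_one, mul_zero, zero_mul, ← mul_assoc (ρ (sl2Torus b⁻¹)),
        hinv, one_mul] using this
    have k₁ := key a₁ a₁' ha₁ hne₁ n₁ m₁ hn₁ hm₁
    have k₂ := key a₂ a₂' ha₂ hne₂ n₂ m₂ hn₂ hm₂
    set J := unipotentSum ρ ψ s * ρ (sl2Weyl F * sl2Torus c) * unipotentSum ρ ψ s'
    set J' := unipotentSum ρ ψ s * ρ (sl2Weyl F * sl2Torus (c * t)) * unipotentSum ρ ψ s'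
    have hdet : ((χ n₁ + χ (-n₁)) * (χ m₂ + χ (-m₂)) -
        (χ n₂ + χ (-n₂)) * (χ m₁ + χ (-m₁))) • J = 0 := by
      calc _ = (χ m₂ + χ (-m₂)) • ((χ n₁ + χ (-n₁)) • J + (χ m₁ + χ (-m₁)) • J') -
            (χ m₁ + χ (-m₁)) • ((χ n₂ + χ (-n₂)) • J + (χ m₂ + χ (-m₂)) • J') := by module
        _ = 0 := by rw [k₁, k₂, smul_zero, smul_zero, sub_zero]
    refine (smul_eq_zero.mp hdet).resolve_left fun hdet0 => hsep ?_
    -- By product-to-sum the determinant is a signed sum of four values $\chi(a)+\chi(-a)$, two of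
    -- each sign. If it is zero, equality of one positive and one negative term forces equality of
    -- the other two, contrary to `hsep`.
    have hprod (n m : ZMod 7) : (χ n + χ (-n)) * (χ m + χ (-m)) =
        (χ (n + m) + χ (-(n + m))) + (χ (n - m) + χ (-(n - m))) := by
      rw [neg_add, neg_sub, sub_eq_add_neg, sub_eq_add_neg]
      simp only [AddChar.map_add_eq_mul]; ring
    rw [hprod, hprod] at hdet0
    constructor
    · rw [← AddChar.add_apply_neg_eq_iff hχ, ← AddChar.add_apply_neg_eq_iff hχ]
      constructor <;> intro heq <;> linear_combination hdet0 - heq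
    · rw [← AddChar.add_apply_neg_eq_iff hχ, ← AddChar.add_apply_neg_eq_iff hχ]
      constructor <;> intro heq <;> linear_combination hdet0 - heq
  have hW : ρ (sl2Weyl F) * ρ (sl2Weyl F) = 1 := by
    rw [← map_mul, sl2Weyl_mul_self, h.map_neg_one]
  -- Summing over $s$, where $\sum_s e_s=49$ is invertible, removes the left projector.
  have hzero (s' : F) (hs' : s' ≠ 0) : unipotentSum ρ ψ s' = 0 := by
    have h1 : ∑ s, unipotentSum ρ ψ s * ρ (sl2Weyl F) * unipotentSum ρ ψ s' = 0 :=
      Finset.sum_eq_zero fun s _ => by simpa using hvanish s s' hs' 1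
    rw [← Finset.sum_mul, ← Finset.sum_mul, sum_unipotentSum ρ ψ hψ, smul_mul_assoc, one_mul,
      smul_mul_assoc] at h1
    have h2 := (smul_eq_zero.mp h1).resolve_left h49
    rw [← one_mul (unipotentSum ρ ψ s'), ← hW, mul_assoc, h2, mul_zero]
  have hone (x : F) : ρ (sl2Upper x) = 1 := by
    have h0 : unipotentSum ρ ψ 0 = (Fintype.card F : K) • (1 : A) := by
      rw [← sum_unipotentSum ρ ψ hψ]
      exact (Finset.sum_eq_single 0 (fun s _ hs => hzero s hs) (by simp)).symm
    have h1 := map_upper_mul_unipotentSum ρ ψ 0 x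
    rw [h0, zero_mul, AddChar.map_zero_eq_one, one_smul, mul_smul_comm, mul_one] at h1
    exact smul_right_injective A h49 h1
  have hweyl (c : Fˣ) : ρ (sl2Weyl F * sl2Torus c) = 1 := by
    have := congrArg ρ (sl2Weyl_upper_weyl c)
    simpa only [map_mul ρ _ (sl2Weyl F), map_mul ρ _ (sl2Upper _), map_mul ρ (sl2Upper _), hone,
      mul_one, one_mul, hW] using this.symm
  have hrel := h.relation 1 (t / 2) (φ ⟨3, 2⟩ * (t / 2)) (by simp; field_simp)
    (by linear_combination (t / 2 : F) * hμ)
  simp only [map_mul ρ _ (sl2Upper _), map_mul ρ (sl2Upper _), hone, hweyl, mul_one] at hrel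
  have : (5 : K) • (1 : A) = 0 := by
    rw [← hrel, show (5 : K) = 1 + 1 + 1 + 1 + 1 by norm_num]
    simp only [add_smul, one_smul]
  exact (smul_eq_zero.mp this).resolve_left h5

end NonDefining

/-! ### Difference operators of the unipotent group -/

section UpperDiff

open Matrix

variable {F M : Type*} [Field F] [AddCommGroup M]
  (ρ : SpecialLinearGroup (Fin 2) F →* AddMonoid.End M)

lemma map_mul_apply_apply (s s' : SpecialLinearGroup (Fin 2) F) (m : M) :
    ρ (s * s') m = ρ s (ρ s' m) := by
  rw [map_mul]; rfl

/-- The difference operator `u(x) - 1`. -/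
def upperDiff (x : F) : AddMonoid.End M := ρ (sl2Upper x) - 1

lemma upperDiff_apply (x : F) (m : M) : upperDiff ρ x m = ρ (sl2Upper x) m - m := rfl

lemma upper_apply (x : F) (m : M) : ρ (sl2Upper x) m = m + upperDiff ρ x m := by
  rw [upperDiff_apply]; abel

lemma upperDiff_zero (m : M) : upperDiff ρ 0 m = 0 := by
  rw [upperDiff_apply, sl2Upper_zero, map_one, AddMonoid.End.one_apply, sub_self]

/-- Expansion of $u(x)u(y)-1$. Differences are thus additive in $x$ as soon as the next differences
vanish, which makes the last nonzero differences additive or biadditive. -/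
lemma upperDiff_add (x y : F) (m : M) :
    upperDiff ρ (x + y) m = upperDiff ρ x m + upperDiff ρ y m +
      upperDiff ρ x (upperDiff ρ y m) := by
  simp only [upperDiff_apply, sl2Upper_add, map_mul_apply_apply, map_sub]
  abel

lemma upperDiff_comm (x y : F) (m : M) :
    upperDiff ρ x (upperDiff ρ y m) = upperDiff ρ y (upperDiff ρ x m) := by
  have h1 := upperDiff_add ρ x y m
  rw [add_comm x y, upperDiff_add, add_comm (upperDiff ρ y m)] at h1
  exact (add_left_cancel h1).symm

lemma torus_upperDiff (a : Fˣ) (x : F) (m : M) :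
    ρ (sl2Torus a) (upperDiff ρ x m) = upperDiff ρ ((a : F) ^ 2 * x) (ρ (sl2Torus a) m) := by
  simp only [upperDiff_apply, map_sub, ← map_mul_apply_apply, sl2Torus_mul_upper]

lemma torus_weyl (a : Fˣ) (m : M) :
    ρ (sl2Torus a) (ρ (sl2Weyl F) m) = ρ (sl2Weyl F) (ρ (sl2Torus a⁻¹) m) := by
  simp only [← map_mul_apply_apply, sl2Weyl_mul_torus, inv_inv]

lemma torus_inv_apply (a : Fˣ) (m : M) : ρ (sl2Torus a⁻¹) (ρ (sl2Torus a) m) = m := by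
  rw [← map_mul_apply_apply, ← map_mul, inv_mul_cancel, map_one, map_one]; rfl

/-- The vectors fixed by the upper unitriangular group. -/
def upperFixed : AddSubgroup M where
  carrier := {m | ∀ x, upperDiff ρ x m = 0}
  zero_mem' x := map_zero _
  add_mem' ha hb x := by rw [map_add, ha, hb, add_zero]
  neg_mem' ha x := by rw [map_neg, ha, neg_zero]

/-- The vectors killed by all products of two difference operators. -/
def upperFixedTwo : AddSubgroup M where
  carrier := {m | ∀ x, upperDiff ρ x m ∈ upperFixed ρ}
  zero_mem' x := by rw [map_zero]; exact zero_mem _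
  add_mem' ha hb x := by rw [map_add]; exact add_mem (ha x) (hb x)
  neg_mem' ha x := by rw [map_neg]; exact neg_mem (ha x)

variable {ρ}

lemma upper_apply_of_mem {m : M} (hm : m ∈ upperFixed ρ) (x : F) : ρ (sl2Upper x) m = m := by
  rw [upper_apply, hm x, add_zero]

lemma upperFixed_le_upperFixedTwo : upperFixed ρ ≤ upperFixedTwo ρ := fun m hm x => by
  rw [hm x]; exact zero_mem _

lemma torus_mem_upperFixed (a : Fˣ) {m : M} (hm : m ∈ upperFixed ρ) :
    ρ (sl2Torus a) m ∈ upperFixed ρ := fun x => by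
  have : x = (a : F) ^ 2 * (((a : F) ^ 2)⁻¹ * x) := by field_simp
  rw [this, ← torus_upperDiff, hm, map_zero]

lemma torus_mem_upperFixedTwo (a : Fˣ) {m : M} (hm : m ∈ upperFixedTwo ρ) :
    ρ (sl2Torus a) m ∈ upperFixedTwo ρ := fun x => by
  have : x = (a : F) ^ 2 * (((a : F) ^ 2)⁻¹ * x) := by field_simp
  rw [this, ← torus_upperDiff]
  exact torus_mem_upperFixed a (hm _)

lemma upperDiff_mem_upperFixedTwo {m : M} (hm : m ∈ upperFixedTwo ρ) (x : F) :
    upperDiff ρ x m ∈ upperFixedTwo ρ := upperFixed_le_upperFixedTwo (hm x)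

variable (ρ) in
/-- A finite `p`-group acting on a `p`-primary section of `M` has a nonzero fixed vector there. -/
lemma exists_upperDiff_mem {p : ℕ} [Fact p.Prime] [Finite F] [CharP F p] [Finite M] {k : ℕ}
    (hk : ∀ m : M, p ^ k • m = 0) {P Q : AddSubgroup M}
    (hP : ∀ x, ∀ m ∈ P, upperDiff ρ x m ∈ P) (hQ : ∀ x, ∀ m ∈ Q, upperDiff ρ x m ∈ Q)
    (h : ¬P ≤ Q) : ∃ m ∈ P, m ∉ Q ∧ ∀ x, upperDiff ρ x m ∈ Q := by
  let N := Q.addSubgroupOf P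
  let f (x : F) : P →+ P := ((ρ (sl2Upper x) : M →+ M).comp P.subtype).codRestrict P fun m => by
    change ρ (sl2Upper x) (m : M) ∈ P
    rw [upper_apply]; exact add_mem m.2 (hP x m m.2)
  have hf (x : F) (m : P) : ((f x m : P) : M) = ρ (sl2Upper x) (m : M) := rfl
  have hfN (x : F) : N ≤ N.comap (f x) := fun m hm => by
    rw [AddSubgroup.mem_comap, AddSubgroup.mem_addSubgroupOf, hf, upper_apply]
    rw [AddSubgroup.mem_addSubgroupOf] at hm
    exact add_mem hm (hQ x m hm)
  let _ : MulAction (Multiplicative F) (P ⧸ N) :=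
    { smul := fun x => QuotientAddGroup.map N N (f x.toAdd) (hfN _)
      one_smul := fun m => by
        obtain ⟨m, rfl⟩ := QuotientAddGroup.mk_surjective m
        change QuotientAddGroup.map N N (f 0) (hfN _) m = m
        rw [QuotientAddGroup.map_mk]
        congr 1
        apply Subtype.ext
        rw [hf, sl2Upper_zero, map_one]; rfl
      mul_smul := fun x y m => by
        obtain ⟨m, rfl⟩ := QuotientAddGroup.mk_surjective m
        change QuotientAddGroup.map N N (f (x.toAdd + y.toAdd)) (hfN _) m =
          QuotientAddGroup.map N N (f x.toAdd) (hfN _)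
            (QuotientAddGroup.map N N (f y.toAdd) (hfN _) m)
        rw [QuotientAddGroup.map_mk, QuotientAddGroup.map_mk, QuotientAddGroup.map_mk]
        congr 1
        apply Subtype.ext
        rw [hf, hf, hf, sl2Upper_add, map_mul_apply_apply] }
  have hsmul (x : F) (m : P) :
      Multiplicative.ofAdd x • (QuotientAddGroup.mk m : P ⧸ N) = QuotientAddGroup.mk (f x m) := rfl
  have hpF : IsPGroup p (Multiplicative F) := fun x => ⟨1, by
    change Multiplicative.ofAdd (p ^ 1 • x.toAdd) = 1
    rw [pow_one, nsmul_eq_mul, CharP.cast_eq_zero, zero_mul]; rfl⟩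
  obtain ⟨m₀, hm₀, hm₀'⟩ := SetLike.not_le_iff_exists.mp h
  have : Nontrivial (P ⧸ N) := ⟨QuotientAddGroup.mk ⟨m₀, hm₀⟩, 0, fun h0 => hm₀' (by
    rw [QuotientAddGroup.eq_zero_iff] at h0
    exact h0)⟩
  have hcard : p ∣ Nat.card (P ⧸ N) := by
    have hp : IsPGroup p (Multiplicative (P ⧸ N)) := fun m => ⟨k, by
      obtain ⟨m', hm⟩ := QuotientAddGroup.mk_surjective m.toAdd
      refine (Multiplicative.toAdd.injective ?_ : _)
      change p ^ k • m.toAdd = 0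
      rw [← hm, ← QuotientAddGroup.mk_nsmul]
      have : p ^ k • m' = 0 := Subtype.ext (hk m')
      rw [this]; rfl⟩
    have : Nontrivial (Multiplicative (P ⧸ N)) := this
    obtain ⟨n, hn, hn'⟩ := hp.nontrivial_iff_card.mp this
    have e : Nat.card (P ⧸ N) = p ^ n := hn'
    rw [e]; exact dvd_pow_self _ hn.ne'
  have h0 : (0 : P ⧸ N) ∈ MulAction.fixedPoints (Multiplicative F) (P ⧸ N) := fun x => by
    change QuotientAddGroup.map N N (f x.toAdd) (hfN _) 0 = 0
    exact map_zero _
  obtain ⟨m, hm, hm0⟩ := hpF.exists_fixed_point_of_prime_dvd_card_of_fixed_point _ hcard h0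
  obtain ⟨m, rfl⟩ := QuotientAddGroup.mk_surjective m
  refine ⟨m, m.2, fun hmQ => hm0 ?_, fun x => ?_⟩
  · symm
    rw [QuotientAddGroup.eq_zero_iff]; exact hmQ
  · have := hm (Multiplicative.ofAdd x)
    rw [hsmul, eq_comm, QuotientAddGroup.eq, AddSubgroup.mem_addSubgroupOf] at this
    rw [upperDiff_apply, sub_eq_neg_add]
    exact this

end UpperDiff

/-! ### Biadditive forms on the field of order 49 -/

section Forms

variable {F M : Type*} [Field F] [AddCommGroup M] {t : F}

lemma seven_eq_zero (hF : Nat.card F = 49) (ht : t ^ 2 = 1 - t) : (7 : F) = 0 := by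
  obtain ⟨φ, -⟩ := QuadSeven.exists_equiv hF ht
  rw [← map_ofNat φ 7, show (7 : QuadSeven) = 0 by decide +kernel, map_zero]

/-- A field of order 49 is additively generated by `1` and `t`. -/
lemma exists_eq_add_zsmul (hF : Nat.card F = 49) (ht : t ^ 2 = 1 - t) (x : F) :
    ∃ i j : ℤ, x = i • 1 + j • t := by
  obtain ⟨φ, hφ⟩ := QuadSeven.exists_equiv hF ht
  obtain ⟨q, rfl⟩ := φ.surjective x
  have : ∀ q : QuadSeven, q = q.re.val • 1 + q.im.val • ⟨0, 1⟩ := by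
    decide +kernel
  refine ⟨q.re.val, q.im.val, ?_⟩
  conv_lhs => rw [this q]
  rw [map_add, map_nsmul, map_nsmul, map_one, hφ, natCast_zsmul, natCast_zsmul]

variable {β : F →+ F →+ M}

lemma biadditive_apply (hsymm : ∀ x y, β x y = β y x) (i j i' j' : ℤ) :
    β (i • 1 + j • t) (i' • 1 + j' • t) =
      (i * i') • β 1 1 + (i * j' + j * i') • β 1 t + (j * j') • β t t := by
  simp only [map_add, map_zsmul, AddMonoidHom.add_apply, AddMonoidHom.zsmul_apply, hsymm t 1]
  module

lemma seven_zsmul_biadditive (hF : Nat.card F = 49) (ht : t ^ 2 = 1 - t) (x y : F) :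
    (7 : ℤ) • β x y = 0 := by
  rw [← map_zsmul, zsmul_eq_mul, Int.cast_ofNat, seven_eq_zero hF ht, zero_mul, map_zero]

/-- A symmetric biadditive form invariant under `3 + 2 * t` is zero. -/
lemma biadditive_eq_zero (hF : Nat.card F = 49) (ht : t ^ 2 = 1 - t)
    (hsymm : ∀ x y, β x y = β y x)
    (hinv : ∀ y, β y y = β ((3 + 2 * t) * y) ((3 + 2 * t) * y)) (x y : F) : β x y = 0 := by
  have s1 := seven_zsmul_biadditive (β := β) hF ht 1 1
  have s2 := seven_zsmul_biadditive (β := β) hF ht 1 t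
  have s3 := seven_zsmul_biadditive (β := β) hF ht t t
  -- Invariance at $1$, $t$ and $1+t$ gives three linear equations in
  -- $\beta(1,1),\beta(1,t),\beta(t,t)$ with only the zero solution modulo 7.
  have h1 := hinv 1
  have h2 := hinv t
  have h3 := hinv (1 + t)
  rw [show (3 + 2 * t) * 1 = (3 : ℤ) • 1 + (2 : ℤ) • t by simp, biadditive_apply hsymm] at h1
  rw [show (3 + 2 * t) * t = (2 : ℤ) • 1 + (1 : ℤ) • t by simp; linear_combination 2 * ht,
    biadditive_apply hsymm] at h2
  rw [show (3 + 2 * t) * (1 + t) = (5 : ℤ) • 1 + (3 : ℤ) • t by simp; linear_combination 2 * ht,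
    biadditive_apply hsymm, show 1 + t = (1 : ℤ) • 1 + (1 : ℤ) • t by simp,
    biadditive_apply hsymm] at h3
  have e1 : β 1 t = -β 1 1 := by linear_combination (norm := module) (-2 : ℤ) • h2 - s1 - s2
  have e2 : β t t = β 1 1 := by
    linear_combination (norm := module) (-2 : ℤ) • h1 - (24 : ℤ) • e1 - s3 + s1
  have e3 : β 1 1 = 0 := by
    linear_combination (norm := module) (-2 : ℤ) • h3 - (56 : ℤ) • e1 - (16 : ℤ) • e2 - s1
  rw [e3] at e1 e2
  obtain ⟨i, j, rfl⟩ := exists_eq_add_zsmul hF ht x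
  obtain ⟨i', j', rfl⟩ := exists_eq_add_zsmul hF ht y
  rw [biadditive_apply hsymm, e1, e2, e3]
  simp

/-- A symmetric biadditive form invariant under `t ^ 2` is a multiple of the trace form of the
norm. -/
lemma biadditive_of_invariant (hF : Nat.card F = 49) (ht : t ^ 2 = 1 - t)
    (hsymm : ∀ x y, β x y = β y x) (hinv : ∀ x y, β (t ^ 2 * x) (t ^ 2 * y) = β x y) :
    β 1 t = (3 : ℤ) • β 1 1 ∧ β t t = (6 : ℤ) • β 1 1 := by
  have s2 := seven_zsmul_biadditive (β := β) hF ht 1 t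
  have h1 := hinv 1 1
  have h2 := hinv 1 t
  have e1 : t ^ 2 * 1 = (1 : ℤ) • 1 + (-1 : ℤ) • t := by simp; linear_combination ht
  have e2 : t ^ 2 * t = (-1 : ℤ) • 1 + (2 : ℤ) • t := by
    simp; linear_combination (t - 1) * ht
  rw [e1, biadditive_apply hsymm] at h1
  rw [e1, e2, biadditive_apply hsymm] at h2
  constructor
  · linear_combination (norm := module) (3 : ℤ) • h2 + (6 : ℤ) • h1 + s2
  · linear_combination (norm := module) (6 : ℤ) • h2 + (13 : ℤ) • h1 + (2 : ℤ) • s2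

lemma eq_zero_of_zsmul_eq_zero {k : ℕ} {m : M} (hk : 7 ^ k • m = 0) {n : ℤ} (hn : ¬7 ∣ n)
    (h : n • m = 0) : m = 0 := by
  have : IsCoprime n (7 ^ k : ℤ) := by
    refine IsCoprime.pow_right ?_
    rw [isCoprime_comm]
    exact (Int.prime_iff_natAbs_prime.mpr (by norm_num)).coprime_iff_not_dvd.mpr hn
  obtain ⟨a, b, hab⟩ := this
  have hk' : (7 ^ k : ℤ) • m = 0 := by
    rw [← hk, ← natCast_zsmul]; push_cast; rfl
  rw [← one_zsmul m, ← hab, add_zsmul, mul_zsmul, mul_zsmul, h, hk', zsmul_zero, zsmul_zero,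
    add_zero]

end Forms

/-! ### Vectors fixed by the unipotent group in a 7-group -/

section PentagonalSeven

open Matrix

variable {F M : Type*} [Field F] [AddCommGroup M] {t : Fˣ} {k : ℕ}
  {ρ : SpecialLinearGroup (Fin 2) F →* AddMonoid.End M}

namespace IsPentagonal

lemma weyl_weyl (h : IsPentagonal ρ t) (m : M) : ρ (sl2Weyl F) (ρ (sl2Weyl F) m) = m := by
  rw [← map_mul_apply_apply, sl2Weyl_mul_self, h.map_neg_one]; rfl

/-- The pentagon relation applied to a vector fixed by the upper unitriangular group. -/
lemma relation_apply (h : IsPentagonal ρ t) {v : M} (hv : v ∈ upperFixed ρ) (c : Fˣ) {y z : F}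
    (hy : 2 * c * y = t) (hz : z * t ^ 3 = y) :
    ρ (sl2Torus c⁻¹) v + (2 : ℤ) • ρ (sl2Weyl F) v +
      (2 : ℤ) • ρ (sl2Weyl F) (ρ (sl2Torus t) v) +
      (upperDiff ρ y (ρ (sl2Weyl F) v) + upperDiff ρ (-y) (ρ (sl2Weyl F) v)) +
      (upperDiff ρ z (ρ (sl2Weyl F) (ρ (sl2Torus t) v)) +
        upperDiff ρ (-z) (ρ (sl2Weyl F) (ρ (sl2Torus t) v))) = 0 := by
  -- Evaluating at $h(c^{-1})v$ reduces the torus parameters $c$ and $ct$ to $1$ and $t$.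
  have hv' := torus_mem_upperFixed (ρ := ρ) c⁻¹ hv
  have key (x : F) (a : Fˣ) : ρ (sl2Upper x * (sl2Weyl F * sl2Torus (c * a)) * sl2Upper x)
      (ρ (sl2Torus c⁻¹) v) = ρ (sl2Weyl F) (ρ (sl2Torus a) v) +
        upperDiff ρ x (ρ (sl2Weyl F) (ρ (sl2Torus a) v)) := by
    rw [map_mul_apply_apply, upper_apply_of_mem hv', map_mul_apply_apply, map_mul_apply_apply,
      ← map_mul_apply_apply ρ (sl2Torus _), ← map_mul, mul_inv_cancel_comm, upper_apply]
  have h1 (m : M) : ρ (sl2Torus 1) m = m := by rw [map_one, map_one]; rfl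
  have : ρ (sl2Torus c⁻¹) v +
      ρ (sl2Upper y * (sl2Weyl F * sl2Torus c) * sl2Upper y) (ρ (sl2Torus c⁻¹) v) +
      ρ (sl2Upper (-y) * (sl2Weyl F * sl2Torus c) * sl2Upper (-y)) (ρ (sl2Torus c⁻¹) v) +
      ρ (sl2Upper z * (sl2Weyl F * sl2Torus (c * t)) * sl2Upper z) (ρ (sl2Torus c⁻¹) v) +
      ρ (sl2Upper (-z) * (sl2Weyl F * sl2Torus (c * t)) * sl2Upper (-z))
        (ρ (sl2Torus c⁻¹) v) = 0 :=
    DFunLike.congr_fun (h.relation c y z hy hz) (ρ (sl2Torus c⁻¹) v)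
  have k1 := key y 1
  have k2 := key (-y) 1
  rw [mul_one, h1] at k1 k2
  rw [k1, k2, key, key] at this
  rw [← this]
  module

/-- A vector fixed by both unitriangular groups is zero. -/
lemma eq_zero_of_weyl_mem (h : IsPentagonal ρ t) (h2 : (2 : F) ≠ 0) (hk : ∀ m : M, 7 ^ k • m = 0)
    {v : M} (hv : v ∈ upperFixed ρ) (hw : ρ (sl2Weyl F) v ∈ upperFixed ρ) : v = 0 := by
  -- The rank-one relation with all unipotents acting trivially. After this the pentagon relation at
  -- $v$ is $5v=0$.
  have key (c : Fˣ) : ρ (sl2Weyl F) (ρ (sl2Torus c) v) = v := by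
    have := congrArg (fun s => ρ s v) (sl2Weyl_upper_weyl c)
    simp only [map_mul_apply_apply] at this
    rw [upper_apply_of_mem hw, h.weyl_weyl, upper_apply_of_mem hv] at this
    have h3 := congrArg (ρ (sl2Upper (c : F)⁻¹)) this
    rwa [upper_apply_of_mem hv, ← map_mul_apply_apply, ← sl2Upper_add, add_neg_cancel,
      sl2Upper_zero, map_one, AddMonoid.End.one_apply, eq_comm] at h3
  have h1 (m : M) : ρ (sl2Torus 1) m = m := by rw [map_one, map_one]; rfl
  have hw1 := key 1
  rw [h1] at hw1
  have ht0 : (t : F) ≠ 0 := t.ne_zero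
  have hrel := h.relation_apply hv 1 (y := t / 2) (z := t / 2 / t ^ 3) (by simp; field_simp)
    (by field_simp)
  rw [inv_one, h1, key, hw1, hv, hv, hv, hv] at hrel
  refine eq_zero_of_zsmul_eq_zero (hk v) (n := 5) (by norm_num) ?_
  rw [← hrel]; module

end IsPentagonal

lemma two_ne_zero_of_card (hF : Nat.card F = 49) (ht : (t : F) ^ 2 = 1 - t) : (2 : F) ≠ 0 :=
  fun h => one_ne_zero (show (1 : F) = 0 by linear_combination seven_eq_zero hF ht - 3 * h)

/-- The sum of all $u(y)$ absorbs $u(x)$, so only the constant terms $-1$ contribute. -/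
lemma sum_upperDiff_upperDiff [Fintype F] (x : F) (m : M) :
    ∑ y, upperDiff ρ x (upperDiff ρ y m) = -(Fintype.card F : ℤ) • upperDiff ρ x m := by
  have (y : F) : upperDiff ρ x (upperDiff ρ y m) =
      upperDiff ρ (x + y) m - upperDiff ρ y m - upperDiff ρ x m := by
    rw [upperDiff_add]; abel
  simp only [this, Finset.sum_sub_distrib, Finset.sum_const, Finset.card_univ]
  rw [Fintype.sum_equiv (Equiv.addLeft x) (fun y => upperDiff ρ (x + y) m)
    (fun y => upperDiff ρ y m) (fun y => rfl)]
  simp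

lemma upperDiff_add_neg (x : F) (m : M) :
    upperDiff ρ x m + upperDiff ρ (-x) m = -upperDiff ρ x (upperDiff ρ (-x) m) := by
  have := upperDiff_add ρ x (-x) m
  rw [add_neg_cancel, upperDiff_zero] at this
  rw [eq_neg_iff_add_eq_zero, ← this]

/-- The biadditive form given by second differences of a vector killed by third differences. -/
def diffForm (m : M) (hm : ∀ x, upperDiff ρ x m ∈ upperFixedTwo ρ) : F →+ F →+ M :=
  AddMonoidHom.mk' (fun x => AddMonoidHom.mk' (fun y => upperDiff ρ x (upperDiff ρ y m))
    fun y z => by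
      rw [upperDiff_add, map_add, map_add, hm z y x, add_zero])
    fun x y => by
      ext z
      change upperDiff ρ (x + y) (upperDiff ρ z m) = _
      rw [upperDiff_add, hm z y x, add_zero]
      rfl

lemma diffForm_apply (m : M) (hm : ∀ x, upperDiff ρ x m ∈ upperFixedTwo ρ) (x y : F) :
    diffForm m hm x y = upperDiff ρ x (upperDiff ρ y m) := rfl

lemma diffForm_self (m : M) (hm : ∀ x, upperDiff ρ x m ∈ upperFixedTwo ρ) (x : F) :
    diffForm m hm x x = upperDiff ρ x m + upperDiff ρ (-x) m := by
  rw [upperDiff_add_neg, ← diffForm_apply m hm, map_neg, neg_neg]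

lemma diffForm_symm (m : M) (hm : ∀ x, upperDiff ρ x m ∈ upperFixedTwo ρ) (x y : F) :
    diffForm m hm x y = diffForm m hm y x := upperDiff_comm ρ x y m

/-- The vectors on which `u(y) + u(-y) - u(μ y) - u(-μ y)` vanishes for all `y`, where
`μ = 3 + 2 * t`. -/
def balanced (ρ : SpecialLinearGroup (Fin 2) F →* AddMonoid.End M) (t : Fˣ) : AddSubgroup M where
  carrier := {m | ∀ y, upperDiff ρ y m + upperDiff ρ (-y) m =
    upperDiff ρ ((3 + 2 * t) * y) m + upperDiff ρ (-((3 + 2 * t) * y)) m}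
  zero_mem' y := by simp
  add_mem' {a b} ha hb y := by
    simp only [map_add]
    rw [add_add_add_comm, ha y, hb y]; abel
  neg_mem' {a} ha y := by
    simp only [map_neg]
    rw [← neg_add, ha y]; abel

/-- Balanced vectors are killed by second differences. -/
lemma balanced_le [Finite M] (hF : Nat.card F = 49) (ht : (t : F) ^ 2 = 1 - t)
    (hk : ∀ m : M, 7 ^ k • m = 0) : balanced ρ t ≤ upperFixedTwo ρ := by
  have : Fact (Nat.Prime 7) := ⟨by norm_num⟩
  have : CharP F 7 := (CharP.charP_iff_prime_eq_zero (by norm_num)).mpr (by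
    exact_mod_cast seven_eq_zero hF ht)
  have : Finite F := Nat.finite_of_card_ne_zero (by omega)
  by_contra hle
  -- For such an $m$ the second differences form a symmetric biadditive form, and balancedness is
  -- its invariance under $3+2t$; so the form vanishes.
  obtain ⟨m, hm, hm', hfix⟩ := exists_upperDiff_mem ρ hk (P := balanced ρ t) (Q := upperFixedTwo ρ)
    (fun x m hm y => by
      simp only [upperDiff_comm ρ _ x]
      rw [← map_add, ← map_add, hm y])
    (fun x m hm => upperDiff_mem_upperFixedTwo hm x) hle
  refine hm' fun y x => ?_
  refine biadditive_eq_zero (β := diffForm m hfix) hF ht (diffForm_symm m hfix) (fun y => ?_) x y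
  rw [diffForm_self, diffForm_self, hm y]

namespace IsPentagonal

variable (h : IsPentagonal ρ t) (hF : Nat.card F = 49) (ht : (t : F) ^ 2 = 1 - t)
  (hk : ∀ m : M, 7 ^ k • m = 0)

include h hF ht hk

/-- The torus element with parameter `t` acts as `-1` on the vectors fixed by the unipotent
group. -/
lemma torus_apply_eq_neg {v : M} (hv : v ∈ upperFixed ρ) : ρ (sl2Torus t) v = -v := by
  have h2 := two_ne_zero_of_card hF ht
  have : Finite F := Nat.finite_of_card_ne_zero (by omega)
  have := Fintype.ofFinite F
  have hcard : Fintype.card F = 49 := by rw [← Nat.card_eq_fintype_card, hF]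
  have hμ : (3 + 2 * t : F) * t ^ 3 = 1 := by
    linear_combination (2 * (t : F) ^ 2 + t + 1) * ht
  have hμ0 : (3 + 2 * t : F) ≠ 0 := left_ne_zero_of_mul_eq_one hμ
  rw [eq_neg_iff_add_eq_zero, add_comm]
  refine h.eq_zero_of_weyl_mem h2 hk (add_mem hv (torus_mem_upperFixed t hv)) fun x => ?_
  rw [map_add]
  set p := ρ (sl2Weyl F) v
  set p' := ρ (sl2Weyl F) (ρ (sl2Torus t) v)
  have key (y : F) (hy : y ≠ 0) : upperDiff ρ x (upperDiff ρ y p) +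
      upperDiff ρ x (upperDiff ρ (-y) p) + (upperDiff ρ x (upperDiff ρ ((3 + 2 * t) * y) p') +
      upperDiff ρ x (upperDiff ρ (-((3 + 2 * t) * y)) p')) =
      (-2 : ℤ) • upperDiff ρ x (p + p') := by
    obtain ⟨c, hc⟩ : ∃ c : Fˣ, (c : F) = t / (2 * y) :=
      ⟨Units.mk0 _ (div_ne_zero t.ne_zero (mul_ne_zero h2 hy)), rfl⟩
    have := congrArg (upperDiff ρ x) (h.relation_apply hv c (y := y) (z := (3 + 2 * t) * y)
      (by rw [hc]; field_simp) (by linear_combination y * hμ))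
    simp only [map_add, map_zsmul, map_zero, torus_mem_upperFixed (ρ := ρ) c⁻¹ hv x] at this ⊢
    rw [← sub_eq_zero, ← this]
    module
  classical
  -- $-96=-2\cdot48$ counts the nonzero $y$. The same sum is $-2\cdot49\,D_x(p+p')$ by
  -- `sum_upperDiff_upperDiff`, and comparison gives $2D_x(p+p')=0$.
  have hsum : ∑ y, (upperDiff ρ x (upperDiff ρ y p) +
      upperDiff ρ x (upperDiff ρ (-y) p) + (upperDiff ρ x (upperDiff ρ ((3 + 2 * t) * y) p') +
      upperDiff ρ x (upperDiff ρ (-((3 + 2 * t) * y)) p'))) =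
      (-96 : ℤ) • upperDiff ρ x (p + p') := by
    rw [← Finset.add_sum_erase _ _ (Finset.mem_univ (0 : F)),
      Finset.sum_congr rfl fun y hy => key y (Finset.ne_of_mem_erase hy)]
    simp only [mul_zero, neg_zero, upperDiff_zero, map_zero, add_zero, zero_add, Finset.sum_const,
      Finset.card_erase_of_mem (Finset.mem_univ (0 : F)), Finset.card_univ, hcard]
    module
  have hmul (f : F → M) : ∑ y, f ((3 + 2 * t) * y) = ∑ y, f y :=
    Fintype.sum_equiv (Equiv.mulLeft₀ _ hμ0) _ _ fun y => rfl
  have hneg (f : F → M) : ∑ y, f (-y) = ∑ y, f y :=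
    Fintype.sum_equiv (Equiv.neg F) _ _ fun y => rfl
  rw [Finset.sum_add_distrib, Finset.sum_add_distrib, Finset.sum_add_distrib,
    hneg fun y => upperDiff ρ x (upperDiff ρ y p),
    hmul fun y => upperDiff ρ x (upperDiff ρ y p'),
    hmul fun y => upperDiff ρ x (upperDiff ρ (-y) p'),
    hneg fun y => upperDiff ρ x (upperDiff ρ y p'), sum_upperDiff_upperDiff,
    sum_upperDiff_upperDiff, hcard] at hsum
  refine eq_zero_of_zsmul_eq_zero (hk _) (n := 2) (by norm_num) ?_
  rw [map_add] at hsum ⊢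
  linear_combination (norm := module) -hsum

/-- As $h(t)v=-v$, the two undifferenced terms in $wv$ and $wh(t)v$ cancel. -/
lemma diff_relation {v : M} (hv : v ∈ upperFixed ρ) (c : Fˣ) {y : F} (hy : 2 * c * y = t) :
    upperDiff ρ y (ρ (sl2Weyl F) v) + upperDiff ρ (-y) (ρ (sl2Weyl F) v) -
      (upperDiff ρ ((3 + 2 * t) * y) (ρ (sl2Weyl F) v) +
        upperDiff ρ (-((3 + 2 * t) * y)) (ρ (sl2Weyl F) v)) = -ρ (sl2Torus c⁻¹) v := by
  have hμ : (3 + 2 * t : F) * t ^ 3 = 1 := by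
    linear_combination (2 * (t : F) ^ 2 + t + 1) * ht
  have := h.relation_apply hv c (z := (3 + 2 * t) * y) hy (by linear_combination y * hμ)
  rw [h.torus_apply_eq_neg hF ht hk hv] at this
  simp only [map_neg] at this
  linear_combination (norm := module) this

lemma torus_inv_apply_eq_neg {v : M} (hv : v ∈ upperFixed ρ) : ρ (sl2Torus t⁻¹) v = -v := by
  have := torus_inv_apply ρ t v
  rwa [h.torus_apply_eq_neg hF ht hk hv, map_neg, neg_eq_iff_eq_neg] at this

variable [Finite M]

/-- The third differences of the image of a fixed vector under the Weyl element vanish. -/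
lemma upperDiff_weyl_mem {v : M} (hv : v ∈ upperFixed ρ) (x : F) :
    upperDiff ρ x (ρ (sl2Weyl F) v) ∈ upperFixedTwo ρ := by
  -- $D_x$ kills the fixed right-hand side of `diff_relation`, so $D_x(wv)$ is balanced.
  refine balanced_le hF ht hk fun y => ?_
  by_cases hy : y = 0
  · simp [hy]
  · have h2 := two_ne_zero_of_card hF ht
    obtain ⟨c, hc⟩ : ∃ c : Fˣ, (c : F) = t / (2 * y) :=
      ⟨Units.mk0 _ (div_ne_zero t.ne_zero (mul_ne_zero h2 hy)), rfl⟩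
    have := congrArg (upperDiff ρ x) (h.diff_relation hF ht hk hv c (y := y)
      (by rw [hc]; field_simp))
    simp only [upperDiff_comm ρ _ x]
    simp only [map_add, map_sub, map_neg, torus_mem_upperFixed (ρ := ρ) c⁻¹ hv x] at this
    linear_combination (norm := module) this

/-- The second differences of `w v` for a vector `v` fixed by the unipotent group. -/
lemma diffForm_weyl {v : M} (hv : v ∈ upperFixed ρ) :
    (7 : ℤ) • v = 0 ∧ ∀ i j i' j' : ℤ,
      upperDiff ρ (i • 1 + j • (t : F)) (upperDiff ρ (i' • 1 + j' • (t : F)) (ρ (sl2Weyl F) v)) =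
        (2 * (i * i') - (i * j' + j * i') - 2 * (j * j')) • v := by
  have hD := h.upperDiff_weyl_mem hF ht hk hv
  have h7 := seven_eq_zero hF ht
  set β := diffForm _ hD with hβ
  have hfix (x y : F) : β x y ∈ upperFixed ρ := hD y x
  have hsymm : ∀ x y, β x y = β y x := diffForm_symm _ hD
  -- $h(t)$ acts as $-1$ on the fixed values of $\beta$, and also on $wv$, so the signs cancel.
  have hinv (x y : F) : β ((t : F) ^ 2 * x) ((t : F) ^ 2 * y) = β x y := by
    have h1 := h.torus_apply_eq_neg hF ht hk (hfix x y)
    have h2 := h.torus_inv_apply_eq_neg hF ht hk hv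
    rw [hβ, diffForm_apply, torus_upperDiff, torus_upperDiff, torus_weyl, h2, map_neg, map_neg,
      map_neg] at h1
    exact neg_injective h1
  obtain ⟨e1, e2⟩ := biadditive_of_invariant hF ht hsymm hinv
  have s7 := seven_zsmul_biadditive (β := β) hF ht 1 1
  -- $y=4t$ solves $2y=t$ modulo 7, and $(3+2t)y=1+4t$. The relation becomes $v=25\,\beta(1,1)$, and
  -- $7\beta=0$ then yields both $7v=0$ and $\beta(1,1)=2v$.
  have hrel := h.diff_relation hF ht hk hv 1 (y := (0 : ℤ) • 1 + (4 : ℤ) • (t : F))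
    (by simp; linear_combination (t : F) * h7)
  rw [← diffForm_self _ hD, ← diffForm_self _ hD, ← hβ,
    show (3 + 2 * t : F) * ((0 : ℤ) • 1 + (4 : ℤ) • (t : F)) = (1 : ℤ) • 1 + (4 : ℤ) • (t : F) by
      simp; linear_combination 8 * ht + h7,
    biadditive_apply hsymm, biadditive_apply hsymm, e1, e2, inv_one,
    show ρ (sl2Torus 1) v = v by rw [map_one, map_one]; rfl] at hrel
  have hb : β 1 1 = (2 : ℤ) • v := by
    linear_combination (norm := module) (-2 : ℤ) • hrel - (7 : ℤ) • s7
  have hv7 : (7 : ℤ) • v = 0 := by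
    linear_combination (norm := module) (7 : ℤ) • hrel + (25 : ℤ) • s7
  refine ⟨hv7, fun i j i' j' => ?_⟩
  rw [← diffForm_apply _ hD, ← hβ, biadditive_apply hsymm, e1, e2, hb]
  linear_combination (norm := module) ((i * j' + j * i') + 2 * (j * j')) • hv7

/-- The torus acts on a fixed vector through the second differences of `w v`. -/
lemma torus_inv_eq {v : M} (hv : v ∈ upperFixed ρ) (c : Fˣ) {y : F} (hy : 2 * c * y = t) :
    ρ (sl2Torus c⁻¹) v =
      upperDiff ρ ((3 + 2 * t) * y) (upperDiff ρ ((3 + 2 * t) * y) (ρ (sl2Weyl F) v)) -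
        upperDiff ρ y (upperDiff ρ y (ρ (sl2Weyl F) v)) := by
  have hD := h.upperDiff_weyl_mem hF ht hk hv
  rw [← diffForm_apply _ hD, ← diffForm_apply _ hD, diffForm_self, diffForm_self, ← neg_sub,
    h.diff_relation hF ht hk hv c hy, neg_neg]

lemma torus_apply_mem_zmultiples {v : M} (hv : v ∈ upperFixed ρ) (c : Fˣ) :
    ρ (sl2Torus c) v ∈ AddSubgroup.zmultiples v := by
  have h2 := two_ne_zero_of_card hF ht
  obtain ⟨-, hform⟩ := h.diffForm_weyl hF ht hk hv
  have hmem (y : F) : upperDiff ρ y (upperDiff ρ y (ρ (sl2Weyl F) v)) ∈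
      AddSubgroup.zmultiples v := by
    obtain ⟨i, j, rfl⟩ := exists_eq_add_zsmul hF ht y
    rw [hform]
    exact AddSubgroup.zsmul_mem_zmultiples v _
  rw [← inv_inv c, h.torus_inv_eq hF ht hk hv c⁻¹ (y := c * t / 2) (by
    rw [Units.val_inv_eq_inv_val]; field_simp)]
  exact sub_mem (hmem _) (hmem _)

/-- The scalar is the norm $9\equiv2$ of 3; $y=5t$ below solves $2\cdot3^{-1}y=t$. -/
lemma torus_three_apply {v : M} (hv : v ∈ upperFixed ρ) {a : Fˣ} (ha : (a : F) = 3) :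
    ρ (sl2Torus a) v = (2 : ℤ) • v := by
  have h7 := seven_eq_zero hF ht
  have h3 : (3 : F) ≠ 0 := by rw [← ha]; exact a.ne_zero
  obtain ⟨hv7, hform⟩ := h.diffForm_weyl hF ht hk hv
  have := h.torus_inv_eq hF ht hk hv a⁻¹ (y := (0 : ℤ) • 1 + (5 : ℤ) • (t : F)) (by
    rw [Units.val_inv_eq_inv_val, ha]; field_simp; simp; linear_combination (t : F) * h7)
  rw [inv_inv, show (3 + 2 * t : F) * ((0 : ℤ) • 1 + (5 : ℤ) • (t : F)) =
    (3 : ℤ) • 1 + (5 : ℤ) • (t : F) by simp; linear_combination 10 * ht + h7, hform, hform] at this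
  rw [this]
  linear_combination (norm := module) (-2 : ℤ) • hv7

/-- Differences of `w v` are additive up to multiples of `v`. -/
lemma upperDiff_add_weyl {v : M} (hv : v ∈ upperFixed ρ) (x y : F) :
    ∃ n : ℤ, upperDiff ρ (x + y) (ρ (sl2Weyl F) v) =
      upperDiff ρ x (ρ (sl2Weyl F) v) + upperDiff ρ y (ρ (sl2Weyl F) v) + n • v := by
  obtain ⟨-, hform⟩ := h.diffForm_weyl hF ht hk hv
  obtain ⟨i, j, rfl⟩ := exists_eq_add_zsmul hF ht x
  obtain ⟨i', j', rfl⟩ := exists_eq_add_zsmul hF ht y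
  exact ⟨_, by rw [upperDiff_add, hform]⟩

end IsPentagonal

end PentagonalSeven

/-! ### Quotients of pentagonal actions -/

section Quotient

open Matrix

variable {F M : Type*} [Field F] [AddCommGroup M] {t : Fˣ}

/-- The action induced on the quotient by an invariant subgroup. -/
def quotientAction (ρ : SpecialLinearGroup (Fin 2) F →* AddMonoid.End M) (S : AddSubgroup M)
    (hS : ∀ s, ∀ m ∈ S, ρ s m ∈ S) : SpecialLinearGroup (Fin 2) F →* AddMonoid.End (M ⧸ S) where
  toFun s := QuotientAddGroup.map S S (ρ s : M →+ M) (hS s)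
  map_one' := by
    refine DFunLike.ext _ _ fun m => ?_
    obtain ⟨m, rfl⟩ := QuotientAddGroup.mk_surjective m
    change ((ρ 1 m : M) : M ⧸ S) = (m : M ⧸ S)
    rw [map_one]; rfl
  map_mul' s s' := by
    refine DFunLike.ext _ _ fun m => ?_
    obtain ⟨m, rfl⟩ := QuotientAddGroup.mk_surjective m
    change ((ρ (s * s') m : M) : M ⧸ S) = ((ρ s (ρ s' m) : M) : M ⧸ S)
    rw [map_mul]; rfl

lemma IsPentagonal.quotientAction {ρ : SpecialLinearGroup (Fin 2) F →* AddMonoid.End M}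
    (h : IsPentagonal ρ t) {S : AddSubgroup M} (hS : ∀ s, ∀ m ∈ S, ρ s m ∈ S) :
    IsPentagonal (quotientAction ρ S hS) t where
  map_neg_one := by
    refine DFunLike.ext _ _ fun m => ?_
    obtain ⟨m, rfl⟩ := QuotientAddGroup.mk_surjective m
    change ((ρ (-1) m : M) : M ⧸ S) = (m : M ⧸ S)
    rw [h.map_neg_one]; rfl
  relation c y z hy hz := by
    refine DFunLike.ext _ _ fun m => ?_
    obtain ⟨m, rfl⟩ := QuotientAddGroup.mk_surjective m
    exact congrArg (QuotientAddGroup.mk (s := S)) (DFunLike.congr_fun (h.relation c y z hy hz) m)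

end Quotient

/-! ### The submodule generated by the fixed vectors -/

section FixedSpan

open Matrix

variable {F M : Type*} [Field F] [AddCommGroup M] {t : Fˣ} {k : ℕ}

/-- The subgroup generated by the differences of `w v`, for fixed vectors `v`. -/
def upperMiddle (ρ : SpecialLinearGroup (Fin 2) F →* AddMonoid.End M) : AddSubgroup M :=
  AddSubgroup.closure {m | ∃ v ∈ upperFixed ρ, ∃ x, m = upperDiff ρ x (ρ (sl2Weyl F) v)}

/-- The submodule generated by the vectors fixed by the upper unitriangular group. -/
def fixedSpan (ρ : SpecialLinearGroup (Fin 2) F →* AddMonoid.End M) : AddSubgroup M :=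
  upperFixed ρ ⊔ (upperMiddle ρ ⊔ (upperFixed ρ).map (ρ (sl2Weyl F) : M →+ M))

variable {ρ : SpecialLinearGroup (Fin 2) F →* AddMonoid.End M}

lemma upperFixed_le_fixedSpan : upperFixed ρ ≤ fixedSpan ρ := le_sup_left

lemma weyl_mem_fixedSpan {v : M} (hv : v ∈ upperFixed ρ) : ρ (sl2Weyl F) v ∈ fixedSpan ρ :=
  (le_sup_right.trans le_sup_right : _ ≤ fixedSpan ρ) (AddSubgroup.mem_map_of_mem _ hv)

lemma upperDiff_weyl_mem_fixedSpan {v : M} (hv : v ∈ upperFixed ρ) (x : F) :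
    upperDiff ρ x (ρ (sl2Weyl F) v) ∈ fixedSpan ρ :=
  (le_sup_left.trans le_sup_right : _ ≤ fixedSpan ρ) (AddSubgroup.subset_closure ⟨v, hv, x, rfl⟩)

/-- A subgroup contains the span of the fixed vectors as soon as it contains the generators. -/
lemma fixedSpan_le {S : AddSubgroup M} (h1 : ∀ v ∈ upperFixed ρ, v ∈ S)
    (h2 : ∀ v ∈ upperFixed ρ, ∀ x, upperDiff ρ x (ρ (sl2Weyl F) v) ∈ S)
    (h3 : ∀ v ∈ upperFixed ρ, ρ (sl2Weyl F) v ∈ S) : fixedSpan ρ ≤ S := by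
  refine sup_le h1 (sup_le ((AddSubgroup.closure_le _).mpr ?_) ?_)
  · rintro _ ⟨v, hv, x, rfl⟩
    exact h2 v hv x
  · rintro _ ⟨v, hv, rfl⟩
    exact h3 v hv

lemma mem_fixedSpan {m : M} : m ∈ fixedSpan ρ ↔ ∃ v ∈ upperFixed ρ, ∃ e ∈ upperMiddle ρ,
    ∃ a ∈ upperFixed ρ, m = v + (e + ρ (sl2Weyl F) a) := by
  simp only [fixedSpan, AddSubgroup.mem_sup]
  constructor
  · rintro ⟨v, hv, _, ⟨e, he, _, ⟨a, ha, rfl⟩, rfl⟩, rfl⟩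
    exact ⟨v, hv, e, he, a, ha, rfl⟩
  · rintro ⟨v, hv, e, he, a, ha, rfl⟩
    exact ⟨v, hv, _, ⟨e, he, _, ⟨a, ha, rfl⟩, rfl⟩, rfl⟩

namespace IsPentagonal

lemma weyl_upperDiff_weyl (h : IsPentagonal ρ t) {v : M} (hv : v ∈ upperFixed ρ) (x : Fˣ) :
    ρ (sl2Weyl F) (upperDiff ρ x (ρ (sl2Weyl F) v)) =
      ρ (sl2Weyl F) (ρ (sl2Torus x) v) +
        upperDiff ρ (-(x : F)⁻¹) (ρ (sl2Weyl F) (ρ (sl2Torus x) v)) - v := by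
  have := congrArg (fun s => ρ s v) (sl2Weyl_upper_weyl x)
  simp only [map_mul_apply_apply] at this
  rw [upper_apply_of_mem hv, upper_apply ρ (-(x : F)⁻¹)] at this
  rw [upperDiff_apply, map_sub, this, h.weyl_weyl]

variable [Finite M] (h : IsPentagonal ρ t) (hF : Nat.card F = 49) (ht : (t : F) ^ 2 = 1 - t)
  (hk : ∀ m : M, 7 ^ k • m = 0)

include h hF ht hk

lemma upperMiddle_le : upperMiddle ρ ≤ upperFixedTwo ρ := by
  refine (AddSubgroup.closure_le _).mpr ?_
  rintro _ ⟨v, hv, x, rfl⟩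
  exact h.upperDiff_weyl_mem hF ht hk hv x

/-- Checked on Bruhat generators: unipotents move generators only by differences already included,
the torus permutes the generators of each kind, and `weyl_upperDiff_weyl` handles $w$ on the middle
layer. -/
lemma fixedSpan_invariant (s) : ∀ m ∈ fixedSpan ρ, ρ s m ∈ fixedSpan ρ := by
  refine sl2_induction (P := fun s => ∀ m ∈ fixedSpan ρ, ρ s m ∈ fixedSpan ρ) ?_ ?_ ?_ ?_ s
  · intro s s' hs hs' m hm
    rw [map_mul_apply_apply]
    exact hs _ (hs' m hm)
  · intro x
    refine fixedSpan_le (S := (fixedSpan ρ).comap (ρ (sl2Upper x) : M →+ M)) ?_ ?_ ?_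
    · intro v hv
      change ρ (sl2Upper x) v ∈ fixedSpan ρ
      rw [upper_apply_of_mem hv]
      exact upperFixed_le_fixedSpan hv
    · intro v hv y
      change ρ (sl2Upper x) (upperDiff ρ y (ρ (sl2Weyl F) v)) ∈ fixedSpan ρ
      rw [upper_apply]
      exact add_mem (upperDiff_weyl_mem_fixedSpan hv y)
        (upperFixed_le_fixedSpan (h.upperDiff_weyl_mem hF ht hk hv y x))
    · intro v hv
      change ρ (sl2Upper x) (ρ (sl2Weyl F) v) ∈ fixedSpan ρ
      rw [upper_apply]
      exact add_mem (weyl_mem_fixedSpan hv) (upperDiff_weyl_mem_fixedSpan hv x)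
  · intro a
    refine fixedSpan_le (S := (fixedSpan ρ).comap (ρ (sl2Torus a) : M →+ M)) ?_ ?_ ?_
    · intro v hv
      exact upperFixed_le_fixedSpan (torus_mem_upperFixed a hv)
    · intro v hv y
      change ρ (sl2Torus a) (upperDiff ρ y (ρ (sl2Weyl F) v)) ∈ fixedSpan ρ
      rw [torus_upperDiff, torus_weyl]
      exact upperDiff_weyl_mem_fixedSpan (torus_mem_upperFixed _ hv) _
    · intro v hv
      change ρ (sl2Torus a) (ρ (sl2Weyl F) v) ∈ fixedSpan ρ
      rw [torus_weyl]
      exact weyl_mem_fixedSpan (torus_mem_upperFixed _ hv)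
  · refine fixedSpan_le (S := (fixedSpan ρ).comap (ρ (sl2Weyl F) : M →+ M)) ?_ ?_ ?_
    · intro v hv
      exact weyl_mem_fixedSpan hv
    · intro v hv y
      change ρ (sl2Weyl F) (upperDiff ρ y (ρ (sl2Weyl F) v)) ∈ fixedSpan ρ
      by_cases hy : y = 0
      · rw [hy, upperDiff_zero, map_zero]; exact zero_mem _
      · lift y to Fˣ using IsUnit.mk0 y hy
        rw [h.weyl_upperDiff_weyl hv]
        have := torus_mem_upperFixed (ρ := ρ) y hv
        exact sub_mem (add_mem (weyl_mem_fixedSpan this) (upperDiff_weyl_mem_fixedSpan this _))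
          (upperFixed_le_fixedSpan hv)
    · intro v hv
      change ρ (sl2Weyl F) (ρ (sl2Weyl F) v) ∈ fixedSpan ρ
      rw [h.weyl_weyl]
      exact upperFixed_le_fixedSpan hv

lemma seven_zsmul_of_mem_fixedSpan {m : M} (hm : m ∈ fixedSpan ρ) : (7 : ℤ) • m = 0 := by
  have h7 (v) (hv : v ∈ upperFixed ρ) := (h.diffForm_weyl hF ht hk hv).1
  refine fixedSpan_le (S := (zsmulAddGroupHom (α := M) 7).ker) ?_ ?_ ?_ hm
  · exact h7
  · intro v hv x
    change (7 : ℤ) • upperDiff ρ x (ρ (sl2Weyl F) v) = 0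
    rw [← map_zsmul, ← map_zsmul, h7 v hv, map_zero, map_zero]
  · intro v hv
    change (7 : ℤ) • ρ (sl2Weyl F) v = 0
    rw [← map_zsmul, h7 v hv, map_zero]

lemma upperDiff_mem_of_mem_fixedSpan {m : M} (hm : m ∈ fixedSpan ρ) (x : F) :
    upperDiff ρ x m ∈ upperFixedTwo ρ := by
  refine fixedSpan_le (S := (upperFixedTwo ρ).comap (upperDiff ρ x : M →+ M)) ?_ ?_ ?_ hm
  · intro v hv
    exact upperDiff_mem_upperFixedTwo (upperFixed_le_upperFixedTwo hv) x
  · intro v hv y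
    exact upperDiff_mem_upperFixedTwo (h.upperDiff_weyl_mem hF ht hk hv y) x
  · intro v hv
    exact h.upperDiff_weyl_mem hF ht hk hv x

lemma torus_three_inv_apply {v : M} (hv : v ∈ upperFixed ρ) {a : Fˣ} (ha : (a : F) = 3) :
    ρ (sl2Torus a⁻¹) v = (4 : ℤ) • v := by
  have h7 := (h.diffForm_weyl hF ht hk hv).1
  have := torus_inv_apply ρ a ((4 : ℤ) • v)
  rw [map_zsmul, h.torus_three_apply hF ht hk hv ha, smul_smul,
    show ((4 * 2 : ℤ)) • v = v by linear_combination (norm := module) h7] at this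
  exact this

/-- Modulo vectors killed by second differences only the component $wa$ with $a$ fixed survives, and
$h(t)wa=wh(t^{-1})a=-wa$. -/
lemma torus_add_mem {m : M} (hm : m ∈ fixedSpan ρ) :
    ρ (sl2Torus t) m + m ∈ upperFixedTwo ρ := by
  obtain ⟨v, hv, e, he, a, ha, rfl⟩ := mem_fixedSpan.mp hm
  have he' := h.upperMiddle_le hF ht hk he
  have hv' := upperFixed_le_upperFixedTwo hv
  rw [map_add, map_add, torus_weyl, h.torus_inv_apply_eq_neg hF ht hk ha, map_neg]
  have : ρ (sl2Torus t) v + (ρ (sl2Torus t) e + -ρ (sl2Weyl F) a) +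
      (v + (e + ρ (sl2Weyl F) a)) = ρ (sl2Torus t) v + v + (ρ (sl2Torus t) e + e) := by abel
  rw [this]
  exact add_mem (add_mem (torus_mem_upperFixedTwo _ hv') hv')
    (add_mem (torus_mem_upperFixedTwo _ he') he')

/-- The middle layer has weight 1 for $h(3)$: $h(3)D_x(wu)=4D_{2x}(wu)\equiv8D_x(wu)$ modulo fixed
vectors, since $3^2=2$ in characteristic 7. -/
lemma torus_three_sub_mem {m : M} (hm : m ∈ fixedSpan ρ) (hm' : m ∈ upperFixedTwo ρ) {a : Fˣ}
    (ha : (a : F) = 3) : ρ (sl2Torus a) m - m ∈ upperFixed ρ := by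
  have h7F := seven_eq_zero hF ht
  obtain ⟨v, hv, e, he, b, hb, rfl⟩ := mem_fixedSpan.mp hm
  have hb' : ρ (sl2Weyl F) b ∈ upperFixedTwo ρ := by
    have := sub_mem (sub_mem hm' (upperFixed_le_upperFixedTwo hv)) (h.upperMiddle_le hF ht hk he)
    simpa using this
  -- $D_1D_1(wb)=2b$ detects the top component.
  have hb0 : b = 0 := by
    have h1 := hb' 1 1
    have h2 := (h.diffForm_weyl hF ht hk hb).2 1 0 1 0
    simp only [one_smul, zero_smul, add_zero] at h2
    rw [h1] at h2
    exact eq_zero_of_zsmul_eq_zero (hk b) (n := 2) (by norm_num) (by simpa using h2.symm)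
  rw [hb0, map_zero, add_zero, map_add]
  have hve : ρ (sl2Torus a) e - e ∈ upperFixed ρ := by
    revert e
    suffices upperMiddle ρ ≤ (upperFixed ρ).comap (ρ (sl2Torus a) - 1 : AddMonoid.End M)
      from fun e he _ _ => this he
    refine (AddSubgroup.closure_le _).mpr ?_
    rintro _ ⟨u, hu, x, rfl⟩
    change ρ (sl2Torus a) (upperDiff ρ x (ρ (sl2Weyl F) u)) -
      upperDiff ρ x (ρ (sl2Weyl F) u) ∈ upperFixed ρ
    have hu7 := (h.diffForm_weyl hF ht hk hu).1
    have hD : (7 : ℤ) • upperDiff ρ x (ρ (sl2Weyl F) u) = 0 := by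
      rw [← map_zsmul, ← map_zsmul, hu7, map_zero, map_zero]
    rw [torus_upperDiff, torus_weyl, h.torus_three_inv_apply hF ht hk hu ha, map_zsmul, map_zsmul,
      ha, show (3 : F) ^ 2 * x = x + x by linear_combination x * h7F, upperDiff_add]
    have : (4 : ℤ) • (upperDiff ρ x (ρ (sl2Weyl F) u) + upperDiff ρ x (ρ (sl2Weyl F) u) +
        upperDiff ρ x (upperDiff ρ x (ρ (sl2Weyl F) u))) - upperDiff ρ x (ρ (sl2Weyl F) u) =
        (4 : ℤ) • upperDiff ρ x (upperDiff ρ x (ρ (sl2Weyl F) u)) := by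
      linear_combination (norm := module) hD
    rw [this]
    exact zsmul_mem (h.upperDiff_weyl_mem hF ht hk hu x x) 4
  have : ρ (sl2Torus a) v + ρ (sl2Torus a) e - (v + e) =
      (ρ (sl2Torus a) v - v) + (ρ (sl2Torus a) e - e) := by abel
  rw [this]
  exact add_mem (sub_mem (torus_mem_upperFixed _ hv) hv) hve

end IsPentagonal

end FixedSpan

/-! ### The fixed vectors generate -/

section Exhaustion

open Matrix

variable {F M : Type*} [Field F] [AddCommGroup M] {t : Fˣ} {k : ℕ}
  {ρ : SpecialLinearGroup (Fin 2) F →* AddMonoid.End M}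

lemma torus_pow_four_apply {a : Fˣ} {m : M} (hm : ρ (sl2Torus a) m = -m) :
    ρ (sl2Torus (a ^ 4)) m = m := by
  rw [show a ^ 4 = a * a * (a * a) by simp only [pow_succ, pow_zero, one_mul, mul_assoc],
    map_mul, map_mul_apply_apply, map_mul,
    map_mul_apply_apply, map_mul_apply_apply, hm]
  simp only [map_neg, hm, neg_neg]

/-- A cube root of unity congruent to `2` modulo `7` in the `7`-adic integers, to finite
precision. -/
lemma exists_cube_root_mod_seven_pow (k : ℕ) :
    ∃ ω : ℤ, 7 ^ k ∣ ω ^ 3 - 1 ∧ ∃ l, ω = 2 + 7 * l := by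
  have : Fact (Nat.Prime 7) := ⟨by norm_num⟩
  -- The Teichmüller approximation: its cube is $8^{7^k}$, and $8\equiv1$ modulo 7.
  refine ⟨2 ^ 7 ^ k, ?_, ?_⟩
  · have := dvd_sub_pow_of_dvd_sub (R := ℤ) (p := 7) (a := 8) (b := 1) (by norm_num) k
    rw [one_pow] at this
    rw [← pow_mul, mul_comm, pow_mul]
    exact (pow_dvd_pow _ (Nat.le_succ k)).trans this
  · have : (7 : ℤ) ∣ 2 ^ 7 ^ k - 2 := by
      have h2 : ((2 : ℤ) : ZMod 7) = ((2 ^ 7 ^ k : ℤ) : ZMod 7) := by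
        push_cast
        exact (ZMod.pow_card_pow _).symm
      exact (ZMod.intCast_eq_intCast_iff_dvd_sub _ _ 7).mp h2
    obtain ⟨l, hl⟩ := this
    exact ⟨l, by linear_combination hl⟩

/-- An endomorphism of finite order fixing a vector modulo a subgroup fixes a vector which is
congruent to a multiple of the given one. -/
lemma exists_fixed_of_pow_eq_one {Y : AddMonoid.End M} {n : ℕ} (hY : Y ^ n = 1)
    {S : AddSubgroup M} (hS : ∀ m ∈ S, Y m ∈ S) {m : M} (hm : Y m - m ∈ S) :
    ∃ v, Y v = v ∧ v - n • m ∈ S ∧ ∀ X : AddMonoid.End M, Commute X Y → X m = m → X v = v := by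
  -- Averaging without the division by $n$.
  refine ⟨(∑ i ∈ Finset.range n, Y ^ i) m, ?_, ?_, fun X hX hXm => ?_⟩
  · have := DFunLike.congr_fun (mul_geom_sum Y n) m
    rw [hY, sub_self] at this
    exact sub_eq_zero.mp this
  · have hpow (i : ℕ) : (Y ^ i) m - m ∈ S := by
      induction i with
      | zero => rw [pow_zero, AddMonoid.End.one_apply, sub_self]; exact zero_mem _
      | succ i ih =>
        have : (Y ^ (i + 1)) m - m = Y ((Y ^ i) m - m) + (Y m - m) := by
          rw [pow_succ', map_sub]
          change Y ((Y ^ i) m) - m = _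
          abel
        rw [this]
        exact add_mem (hS _ ih) hm
    have : (∑ i ∈ Finset.range n, Y ^ i) m - n • m = ∑ i ∈ Finset.range n, ((Y ^ i) m - m) := by
      rw [Finset.sum_sub_distrib, Finset.sum_const, Finset.card_range]
      congr 1
      exact AddMonoidHom.finsetSum_apply _ _ _
    rw [this]
    exact sum_mem fun i _ => hpow i
  · have := DFunLike.congr_fun
      (Commute.sum_right (Finset.range n) (fun i => Y ^ i) X fun i _ => hX.pow_right i).eq m
    change X (_ : M) = (∑ i ∈ Finset.range n, Y ^ i) (X m) at this
    rwa [hXm] at this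

namespace IsPentagonal

lemma torus_eq_of_val_eq_neg_one (h : IsPentagonal ρ t) {a : Fˣ} (ha : (a : F) = -1) (m : M) :
    ρ (sl2Torus a) m = m := by
  have : sl2Torus a = -1 := by
    ext i j; fin_cases i <;> fin_cases j <;> simp [coe_sl2Torus, ha]
  rw [this, h.map_neg_one]; rfl

variable (h : IsPentagonal ρ t) (hF : Nat.card F = 49) (ht : (t : F) ^ 2 = 1 - t)
  (hk : ∀ m : M, 7 ^ k • m = 0)

include h ht in
/-- On a `7`-primary module a vector which is an eigenvector of the torus elements of parameters
`t` and `3` modulo a subgroup, with the eigenvalues of a vector fixed by the unipotent group, can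
be lifted to an eigenvector. -/
lemma exists_torus_eigenvector {S : AddSubgroup M} (hS : ∀ s, ∀ m ∈ S, ρ s m ∈ S)
    (h7F : (7 : F) = 0) (hk : ∀ m : M, 7 ^ k • m = 0) {a : Fˣ} (ha : (a : F) = 3) {m : M}
    (hm : m ∉ S) (hm7 : (7 : ℤ) • m ∈ S) (hmt : ρ (sl2Torus t) m + m ∈ S)
    (hma : ρ (sl2Torus a) m - (2 : ℤ) • m ∈ S) :
    ∃ (n ω : ℤ) (v : M), v ∉ S ∧ v - n • m ∈ S ∧ (∃ l, ω = 2 + 7 * l) ∧ ρ (sl2Torus t) v = -v ∧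
      ρ (sl2Torus a) v = ω • v := by
  obtain ⟨ω, hω, l, hl⟩ := exists_cube_root_mod_seven_pow k
  have hω (m : M) : ω ^ 3 • m = m := by
    obtain ⟨q, hq⟩ := hω
    rw [show ω ^ 3 = 1 + q * 7 ^ k by linear_combination hq, add_zsmul, mul_zsmul, one_zsmul]
    have : (7 ^ k : ℤ) • m = 0 := by rw [← hk m, ← natCast_zsmul]; push_cast; rfl
    rw [this, zsmul_zero, add_zero]
  -- $t^8=-1$ and $3^3=-1$ in the field and $h(-1)$ acts trivially, so $Z^8=1$ and $Y^3=1$. Both fix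
  -- $m$ modulo $S$ and have order prime to 7; averaging multiplies $m$ by $24=8\cdot3$, a unit
  -- modulo 7.
  set Z : AddMonoid.End M := -ρ (sl2Torus t) with hZ
  set Y : AddMonoid.End M := ω ^ 2 • ρ (sl2Torus a) with hY
  have hZ1 : Z ^ 8 = 1 := by
    refine DFunLike.ext _ _ fun m => ?_
    rw [hZ, Even.neg_pow (by decide), ← map_pow, ← map_pow]
    exact h.torus_eq_of_val_eq_neg_one (by
      rw [Units.val_pow_eq_pow_val]
      linear_combination (((t : F) ^ 6 - (t : F) ^ 5 + 2 * (t : F) ^ 4 - 3 * (t : F) ^ 3 +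
        5 * (t : F) ^ 2 - 8 * t + 13) * ht) + (2 - 3 * t) * h7F) m
  have hY1 : Y ^ 3 = 1 := by
    refine DFunLike.ext _ _ fun m => ?_
    rw [hY, smul_pow, ← map_pow, ← map_pow]
    change (ω ^ 2) ^ 3 • ρ (sl2Torus (a ^ 3)) m = m
    rw [h.torus_eq_of_val_eq_neg_one (by
      rw [Units.val_pow_eq_pow_val, ha]; linear_combination 4 * h7F) m,
      show (ω ^ 2) ^ 3 = ω ^ 3 * ω ^ 3 by ring, mul_zsmul, hω, hω]
  have hYZ : Commute Z Y := by
    have : Commute (ρ (sl2Torus t)) (ρ (sl2Torus a)) := by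
      rw [commute_iff_eq, ← map_mul, ← map_mul, ← map_mul, ← map_mul, mul_comm]
    exact (this.smul_right _).neg_left
  have hZS : ∀ m ∈ S, Z m ∈ S := fun m hm => neg_mem (hS _ m hm)
  have hYS : ∀ m ∈ S, Y m ∈ S := fun m hm => zsmul_mem (hS _ m hm) _
  obtain ⟨u, hu, hum, -⟩ := exists_fixed_of_pow_eq_one hZ1 hZS (m := m) (by
    change -ρ (sl2Torus t) m - m ∈ S
    rw [← neg_add']; exact neg_mem hmt)
  obtain ⟨v, hv, hvu, hZv⟩ := exists_fixed_of_pow_eq_one hY1 hYS (m := u) (by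
    have hYm : Y m - m ∈ S := by
      change ω ^ 2 • ρ (sl2Torus a) m - m ∈ S
      have : ω ^ 2 • ρ (sl2Torus a) m - m =
          ω ^ 2 • (ρ (sl2Torus a) m - (2 : ℤ) • m) + (1 + 8 * l + 14 * l ^ 2) • (7 : ℤ) • m := by
        rw [hl]; module
      rw [this]
      exact add_mem (zsmul_mem hma _) (zsmul_mem hm7 _)
    have : Y u - u = Y (u - 8 • m) - (u - 8 • m) + 8 • (Y m - m) := by
      rw [map_sub, map_nsmul]; module
    rw [this]
    exact add_mem (sub_mem (hYS _ hum) hum) (nsmul_mem hYm _))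
  have hvm : v - (24 : ℤ) • m ∈ S := by
    have : v - (24 : ℤ) • m = (v - 3 • u) + 3 • (u - 8 • m) := by module
    rw [this]
    exact add_mem hvu (nsmul_mem hum _)
  refine ⟨24, ω, v, fun hvS => hm ?_, hvm, ⟨l, hl⟩, ?_, ?_⟩
  · have : m = (2 : ℤ) • (v - (24 : ℤ) • m) - (2 : ℤ) • v + (7 : ℤ) • (7 : ℤ) • m := by module
    rw [this]
    exact add_mem (sub_mem (zsmul_mem hvm _) (zsmul_mem hvS _)) (zsmul_mem hm7 _)
  · have : -ρ (sl2Torus t) v = v := hZv Z hYZ hu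
    rw [← this, neg_neg, this]
  · have : ω ^ 2 • ρ (sl2Torus a) v = v := hv
    conv_rhs => rw [← this, smul_smul, show ω * ω ^ 2 = ω ^ 3 by ring, hω]

variable [Finite M]

include h hF ht hk

/-- Over a `7`-group the fixed vectors of the unipotent group generate. -/
lemma fixedSpan_eq_top : fixedSpan ρ = ⊤ := by
  have : Fact (Nat.Prime 7) := ⟨by norm_num⟩
  have h7F := seven_eq_zero hF ht
  have : CharP F 7 := (CharP.charP_iff_prime_eq_zero (by norm_num)).mpr (by exact_mod_cast h7F)
  have : Finite F := Nat.finite_of_card_ne_zero (by omega)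
  have h3 : (3 : F) ≠ 0 := fun h3 => one_ne_zero (show (1 : F) = 0 by
    linear_combination h7F - 2 * h3)
  obtain ⟨a, ha⟩ : ∃ a : Fˣ, (a : F) = 3 := ⟨Units.mk0 _ h3, rfl⟩
  by_contra htop
  have hS := h.fixedSpan_invariant hF ht hk
  have hSD (x) : ∀ m ∈ fixedSpan ρ, upperDiff ρ x m ∈ fixedSpan ρ := fun m hm =>
    sub_mem (hS _ m hm) hm
  obtain ⟨m, -, hm, hmD⟩ := exists_upperDiff_mem ρ hk (P := ⊤) (Q := fixedSpan ρ)
    (fun _ _ _ => AddSubgroup.mem_top _) hSD (fun hle => htop (top_le_iff.mp hle))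
  -- the weights of `m` modulo the span of the fixed vectors
  have hq := h.quotientAction hS
  have hkq : ∀ m : M ⧸ fixedSpan ρ, 7 ^ k • m = 0 := fun m => by
    obtain ⟨m, rfl⟩ := QuotientAddGroup.mk_surjective m
    rw [← QuotientAddGroup.mk_nsmul, hk m]; rfl
  have hmq : (m : M ⧸ fixedSpan ρ) ∈ upperFixed (_root_.quotientAction ρ _ hS) := fun x =>
    (QuotientAddGroup.eq_zero_iff _).mpr (hmD x)
  have hmt : ρ (sl2Torus t) m + m ∈ fixedSpan ρ := by
    have := hq.torus_apply_eq_neg hF ht hkq hmq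
    rw [eq_neg_iff_add_eq_zero] at this
    exact (QuotientAddGroup.eq_zero_iff _).mp this
  have hm7 : (7 : ℤ) • m ∈ fixedSpan ρ :=
    (QuotientAddGroup.eq_zero_iff _).mp (hq.diffForm_weyl hF ht hkq hmq).1
  have hma : ρ (sl2Torus a) m - (2 : ℤ) • m ∈ fixedSpan ρ := by
    have := hq.torus_three_apply hF ht hkq hmq ha
    rw [← sub_eq_zero] at this
    exact (QuotientAddGroup.eq_zero_iff _).mp this
  obtain ⟨n, ω, v, hvS, hvm, ⟨l, hω⟩, hvt, hva⟩ :=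
    h.exists_torus_eigenvector ht hS h7F hk ha hm hm7 hmt hma
  have hvD (x : F) : upperDiff ρ x v ∈ fixedSpan ρ := by
    have : upperDiff ρ x v = upperDiff ρ x (v - n • m) + n • upperDiff ρ x m := by
      rw [map_sub, map_zsmul]; abel
    rw [this]
    exact add_mem (hSD x _ hvm) (zsmul_mem (hmD x) n)
  -- an additive function that is invariant under multiplication by `t ^ 2` vanishes
  have hvanish (γ : F →+ M) (hγ : ∀ x, γ ((t : F) ^ 2 * x) = γ x) (x : F) : γ x = 0 := by
    -- $t^2-1=-t$ is a unit, so every $x$ has the form $(t^2-1)x'$.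
    have := hγ (-(t : F)⁻¹ * x)
    rw [← sub_eq_zero, ← map_sub] at this
    have ht0 := t.ne_zero
    rw [← this]; congr 1; field_simp; linear_combination x * ht
  have htv (x : F) : ρ (sl2Torus t) (upperDiff ρ x v) = -upperDiff ρ ((t : F) ^ 2 * x) v := by
    rw [torus_upperDiff, hvt, map_neg]
  -- the differences of `v` are killed by second differences
  have hD2 (x : F) : upperDiff ρ x v ∈ upperFixedTwo ρ := fun y z => by
    let γ : F →+ M := AddMonoidHom.mk' (fun x => upperDiff ρ z (upperDiff ρ y (upperDiff ρ x v)))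
      fun x x' => by
        have := h.upperDiff_mem_of_mem_fixedSpan hF ht hk (hvD x') x y z
        rw [upperDiff_add, map_add, map_add, map_add, map_add, this, add_zero]
    refine hvanish γ (fun x => ?_) x
    have := h.torus_add_mem hF ht hk (hvD x) y z
    rw [htv, map_add, map_add, map_neg, map_neg, neg_add_eq_zero] at this
    exact this
  -- they are even fixed
  have hD1 (x : F) : upperDiff ρ x v ∈ upperFixed ρ := fun y => by
    have hadd (x x' : F) : upperDiff ρ y (upperDiff ρ (x + x') v) =
        upperDiff ρ y (upperDiff ρ x v) + upperDiff ρ y (upperDiff ρ x' v) := by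
      rw [upperDiff_add, map_add, map_add, hD2 x' x y, add_zero]
    have := h.torus_three_sub_mem hF ht hk (hvD x) (hD2 x) ha y
    rw [torus_upperDiff, hva, ha, show (3 : F) ^ 2 * x = x + x by linear_combination x * h7F,
      map_zsmul, map_sub, map_zsmul, hadd, hω] at this
    -- $2\omega-1=3+14l$: the weight $2\omega\equiv4$ of $D_xv$ differs from the weight 1 of the
    -- middle layer.
    refine eq_zero_of_zsmul_eq_zero (hk _) (n := 3 + 14 * l) (by omega) ?_
    rw [← this]; module
  have hD0 (x : F) : upperDiff ρ x v = 0 := by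
    let γ : F →+ M := AddMonoidHom.mk' (fun x => upperDiff ρ x v) fun x x' => by
      rw [upperDiff_add, hD1 x' x, add_zero]
    refine hvanish γ (fun x => ?_) x
    have := h.torus_apply_eq_neg hF ht hk (hD1 x)
    rw [htv] at this
    exact neg_injective this
  exact hvS (upperFixed_le_fixedSpan hD0)

/-! ### Torus weights and equivariant pairings -/

/-- The module is a sum of simultaneous eigenspaces of two torus elements. -/
lemma exists_weights {a : Fˣ} (ha : (a : F) = 3) (m : M) :
    ∃ m₁ m₂ m₄ : M, m = m₁ + m₂ + m₄ ∧
      (ρ (sl2Torus a) m₁ = m₁ ∧ ρ (sl2Torus (t ^ 4)) m₁ = -m₁) ∧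
      (ρ (sl2Torus a) m₂ = (2 : ℤ) • m₂ ∧ ρ (sl2Torus t) m₂ = -m₂) ∧
      (ρ (sl2Torus a) m₄ = (4 : ℤ) • m₄ ∧ ρ (sl2Torus t) m₄ = -m₄) := by
  have h7F := seven_eq_zero hF ht
  let S : AddSubgroup M :=
    { carrier := {m | ∃ m₁ m₂ m₄ : M, m = m₁ + m₂ + m₄ ∧
        (ρ (sl2Torus a) m₁ = m₁ ∧ ρ (sl2Torus (t ^ 4)) m₁ = -m₁) ∧
        (ρ (sl2Torus a) m₂ = (2 : ℤ) • m₂ ∧ ρ (sl2Torus t) m₂ = -m₂) ∧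
        (ρ (sl2Torus a) m₄ = (4 : ℤ) • m₄ ∧ ρ (sl2Torus t) m₄ = -m₄)}
      zero_mem' := ⟨0, 0, 0, by simp⟩
      add_mem' := by
        rintro _ _ ⟨x₁, x₂, x₄, rfl, ⟨p₁, q₁⟩, ⟨p₂, q₂⟩, p₄, q₄⟩
          ⟨y₁, y₂, y₄, rfl, ⟨p₁', q₁'⟩, ⟨p₂', q₂'⟩, p₄', q₄'⟩
        refine ⟨x₁ + y₁, x₂ + y₂, x₄ + y₄, by abel, ?_⟩
        simp only [map_add, p₁, q₁, p₂, q₂, p₄, q₄, p₁', q₁', p₂', q₂', p₄', q₄', smul_add,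
          neg_add, and_self]
      neg_mem' := by
        rintro _ ⟨x₁, x₂, x₄, rfl, ⟨p₁, q₁⟩, ⟨p₂, q₂⟩, p₄, q₄⟩
        refine ⟨-x₁, -x₂, -x₄, by abel, ?_⟩
        simp only [map_neg, p₁, q₁, p₂, q₂, p₄, q₄, smul_neg, and_self] }
  have h2 (v) (hv : v ∈ upperFixed ρ) : v ∈ S :=
    ⟨0, v, 0, by simp, by simp, ⟨h.torus_three_apply hF ht hk hv ha,
      h.torus_apply_eq_neg hF ht hk hv⟩, by simp⟩
  have h4 (v) (hv : v ∈ upperFixed ρ) : ρ (sl2Weyl F) v ∈ S :=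
    ⟨0, 0, ρ (sl2Weyl F) v, by simp, by simp, by simp,
      by rw [torus_weyl, h.torus_three_inv_apply hF ht hk hv ha, map_zsmul],
      by rw [torus_weyl, h.torus_inv_apply_eq_neg hF ht hk hv, map_neg]⟩
  suffices fixedSpan ρ ≤ S from this (h.fixedSpan_eq_top hF ht hk ▸ AddSubgroup.mem_top m)
  refine fixedSpan_le h2 (fun v hv x => ?_) h4
  have hv7 := (h.diffForm_weyl hF ht hk hv).1
  set D : F → M := fun x => upperDiff ρ x (ρ (sl2Weyl F) v) with hD
  have hDv : ∀ x, D x + D (-x) ∈ upperFixed ρ := fun x => by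
    rw [hD]
    dsimp only
    rw [upperDiff_add_neg]
    exact neg_mem (h.upperDiff_weyl_mem hF ht hk hv _ _)
  have hD7 : (7 : ℤ) • D x = 0 := by rw [hD, ← map_zsmul, ← map_zsmul, hv7, map_zero, map_zero]
  have hD7' : (7 : ℤ) • D (-x) = 0 := by
    rw [hD, ← map_zsmul, ← map_zsmul, hv7, map_zero, map_zero]
  -- Since $4$ is $1/2$ modulo 7, this is the splitting into odd and even parts in $x$. The even
  -- part is a fixed vector, of weight 2; the odd part has weight 1, and $h(t^4)$ negates it because
  -- $t^8=-1$.
  have e : D x = (4 : ℤ) • (D x - D (-x)) + (4 : ℤ) • (D x + D (-x)) := by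
    linear_combination (norm := module) -hD7
  change D x ∈ S
  rw [e]
  refine add_mem ⟨(4 : ℤ) • (D x - D (-x)), 0, 0, by simp, ⟨?_, ?_⟩, by simp, by simp⟩
    (h2 _ (zsmul_mem (hDv x) 4))
  · have hDadd (x : F) : D (x + x) = (2 : ℤ) • D x + upperDiff ρ x (D x) := by
      rw [hD]
      dsimp only
      rw [upperDiff_add]; module
    have hneg : upperDiff ρ (-x) (D (-x)) = upperDiff ρ x (D x) := by
      have := diffForm_apply _ (h.upperDiff_weyl_mem hF ht hk hv) (-x) (-x)
      rw [map_neg, map_neg, AddMonoidHom.neg_apply, neg_neg] at this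
      exact this.symm
    have hθ (x : F) : ρ (sl2Torus a) (D x) = (4 : ℤ) • D (x + x) := by
      rw [hD]
      dsimp only
      rw [torus_upperDiff, torus_weyl, h.torus_three_inv_apply hF ht hk hv ha, map_zsmul,
        map_zsmul, ha, show (3 : F) ^ 2 * x = x + x by linear_combination x * h7F]
    rw [map_zsmul, map_sub, hθ, hθ, hDadd, hDadd, hneg]
    linear_combination (norm := module) (4 : ℤ) • (hD7 - hD7')
  · have ht8 : ((t ^ 4 : Fˣ) : F) ^ 2 = -1 := by
      rw [Units.val_pow_eq_pow_val]
      linear_combination (((t : F) ^ 6 - (t : F) ^ 5 + 2 * (t : F) ^ 4 - 3 * (t : F) ^ 3 +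
        5 * (t : F) ^ 2 - 8 * t + 13) * ht) + (2 - 3 * t) * h7F
    have hinv : ρ (sl2Torus (t ^ 4)⁻¹) v = v := by
      have h1 := h.torus_inv_apply_eq_neg hF ht hk hv
      rw [← inv_pow, torus_pow_four_apply h1]
    have hθ (x : F) : ρ (sl2Torus (t ^ 4)) (D x) = D (-x) := by
      rw [hD]
      dsimp only
      rw [torus_upperDiff, torus_weyl, hinv, ht8, neg_one_mul]
    rw [map_zsmul, map_sub, hθ, hθ, neg_neg]
    module

/-- Eigenvectors of the torus element of parameter `3`. -/
lemma torus_three_eigenvector {a : Fˣ} (ha : (a : F) = 3) (m : M) :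
    (ρ (sl2Torus a) m = m → ρ (sl2Torus (t ^ 4)) m = -m) ∧
    (ρ (sl2Torus a) m = (2 : ℤ) • m → ρ (sl2Torus t) m = -m) ∧
    (ρ (sl2Torus a) m = (4 : ℤ) • m → ρ (sl2Torus t) m = -m) := by
  have h7 (m : M) : (7 : ℤ) • m = 0 :=
    h.seven_zsmul_of_mem_fixedSpan hF ht hk (h.fixedSpan_eq_top hF ht hk ▸ AddSubgroup.mem_top m)
  obtain ⟨m₁, m₂, m₄, rfl, ⟨p₁, q₁⟩, ⟨p₂, q₂⟩, p₄, q₄⟩ := h.exists_weights hF ht hk ha m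
  have h71 := h7 m₁
  have h72 := h7 m₂
  have h74 := h7 m₄
  simp only [map_add, p₁, p₂, p₄]
  refine ⟨fun hm => ?_, fun hm => ?_, fun hm => ?_⟩
  · have hm' := congrArg (ρ (sl2Torus a)) hm
    simp only [map_add, map_zsmul, p₁, p₂, p₄] at hm'
    have e4 : m₄ = 0 := by linear_combination (norm := module) (2 : ℤ) • hm - hm' + h74
    have e2 : m₂ = 0 := by linear_combination (norm := module) hm - (3 : ℤ) • e4
    rw [e2, e4, map_zero, q₁]; abel
  · have hm' := congrArg (ρ (sl2Torus a)) hm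
    simp only [map_add, map_zsmul, p₁, p₂, p₄] at hm'
    have e4 : m₄ = 0 := by linear_combination (norm := module) hm - hm' + h74
    have e1 : m₁ = 0 := by linear_combination (norm := module) (2 : ℤ) • e4 - hm
    rw [e1, e4, map_zero, q₂]; abel
  · have hm' := congrArg (ρ (sl2Torus a)) hm
    simp only [map_add, map_zsmul, p₁, p₂, p₄] at hm'
    have e1 : m₁ = 0 := by
      linear_combination (norm := module) (-2 : ℤ) • hm' + (4 : ℤ) • hm + h71
    have e2 : m₂ = 0 := by
      linear_combination (norm := module) (3 : ℤ) • hm + (9 : ℤ) • e1 + h72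
    rw [e1, e2, map_zero, q₄]; abel

end IsPentagonal

/-- There is no nonzero equivariant biadditive map between pentagonal `7`-groups. -/
lemma equivariant_biadditive_eq_zero {M' : Type*} [AddCommGroup M'] [Finite M] [Finite M']
    {ρ' : SpecialLinearGroup (Fin 2) F →* AddMonoid.End M'} (h : IsPentagonal ρ t)
    (h' : IsPentagonal ρ' t) (hF : Nat.card F = 49) (ht : (t : F) ^ 2 = 1 - t)
    (hk : ∀ m : M, 7 ^ k • m = 0) (hk' : ∀ m : M', 7 ^ k • m = 0) (c : M →+ M →+ M')
    (hc : ∀ s a b, c (ρ s a) (ρ s b) = ρ' s (c a b)) : c = 0 := by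
  have h7F := seven_eq_zero hF ht
  have h3 : (3 : F) ≠ 0 := fun h3 => one_ne_zero (show (1 : F) = 0 by
    linear_combination h7F - 2 * h3)
  obtain ⟨a, ha⟩ : ∃ a : Fˣ, (a : F) = 3 := ⟨Units.mk0 _ h3, rfl⟩
  have h7 (m : M') : (7 : ℤ) • m = 0 := h'.seven_zsmul_of_mem_fixedSpan hF ht hk'
    (h'.fixedSpan_eq_top hF ht hk' ▸ AddSubgroup.mem_top m)
  have hneg {m : M'} (hm : m = -m) : m = 0 := by
    linear_combination (norm := module) (4 : ℤ) • hm - h7 m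
  ext m m'
  obtain ⟨m₁, m₂, m₄, rfl, ⟨p₁, q₁⟩, ⟨p₂, q₂⟩, p₄, q₄⟩ := h.exists_weights hF ht hk ha m
  obtain ⟨n₁, n₂, n₄, rfl, ⟨x₁, y₁⟩, ⟨x₂, y₂⟩, x₄, y₄⟩ := h.exists_weights hF ht hk ha m'
  have one {x : M'} (h1 : ρ' (sl2Torus a) x = x) (h2 : ρ' (sl2Torus (t ^ 4)) x = x) : x = 0 :=
    hneg (h2.symm.trans ((h'.torus_three_eigenvector hF ht hk' ha x).1 h1))
  have two {x : M'} (h1 : ρ' (sl2Torus a) x = (2 : ℤ) • x) (h2 : ρ' (sl2Torus t) x = x) : x = 0 :=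
    hneg (h2.symm.trans ((h'.torus_three_eigenvector hF ht hk' ha x).2.1 h1))
  have four {x : M'} (h1 : ρ' (sl2Torus a) x = (4 : ℤ) • x) (h2 : ρ' (sl2Torus t) x = x) :
      x = 0 :=
    hneg (h2.symm.trans ((h'.torus_three_eigenvector hF ht hk' ha x).2.2 h1))
  have two' {x : M'} (h1 : ρ' (sl2Torus a) x = (2 : ℤ) • x)
      (h2 : ρ' (sl2Torus (t ^ 4)) x = -x) : x = 0 :=
    hneg ((torus_pow_four_apply ((h'.torus_three_eigenvector hF ht hk' ha x).2.1 h1)).symm.trans h2)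
  have four' {x : M'} (h1 : ρ' (sl2Torus a) x = (4 : ℤ) • x)
      (h2 : ρ' (sl2Torus (t ^ 4)) x = -x) : x = 0 :=
    hneg ((torus_pow_four_apply ((h'.torus_three_eigenvector hF ht hk' ha x).2.2 h1)).symm.trans h2)
  have q₂' := torus_pow_four_apply q₂
  have q₄' := torus_pow_four_apply q₄
  have y₂' := torus_pow_four_apply y₂
  have y₄' := torus_pow_four_apply y₄
  -- Weights of $h(3)$ multiply within $\{1,2,4\}$ modulo 7. In each case the sign of $h(t)$ or
  -- $h(t^4)$ on the product is opposite to the one that its weight requires.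
  have c11 : c m₁ n₁ = 0 := one (by rw [← hc, p₁, x₁]) (by rw [← hc, q₁, y₁]; simp)
  have c12 : c m₁ n₂ = 0 := two' (by rw [← hc, p₁, x₂]; simp) (by rw [← hc, q₁, y₂']; simp)
  have c14 : c m₁ n₄ = 0 := four' (by rw [← hc, p₁, x₄]; simp) (by rw [← hc, q₁, y₄']; simp)
  have c21 : c m₂ n₁ = 0 := two' (by rw [← hc, p₂, x₁]; simp) (by rw [← hc, q₂', y₁]; simp)
  have c41 : c m₄ n₁ = 0 := four' (by rw [← hc, p₄, x₁]; simp) (by rw [← hc, q₄', y₁]; simp)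
  have c22 : c m₂ n₂ = 0 := four (by rw [← hc, p₂, x₂]; simp [smul_smul])
    (by rw [← hc, q₂, y₂]; simp)
  have c24 : c m₂ n₄ = 0 := one (by
    rw [← hc, p₂, x₄, map_zsmul, map_zsmul, AddMonoidHom.zsmul_apply]
    linear_combination (norm := module) h7 (c m₂ n₄)) (by rw [← hc, q₂', y₄'])
  have c42 : c m₄ n₂ = 0 := one (by
    rw [← hc, p₄, x₂, map_zsmul, map_zsmul, AddMonoidHom.zsmul_apply]
    linear_combination (norm := module) h7 (c m₄ n₂)) (by rw [← hc, q₄', y₂'])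
  have c44 : c m₄ n₄ = 0 := two (by
    rw [← hc, p₄, x₄, map_zsmul, map_zsmul, AddMonoidHom.zsmul_apply]
    linear_combination (norm := module) (2 : ℤ) • h7 (c m₄ n₄)) (by rw [← hc, q₄, y₄]; simp)
  simp only [map_add, AddMonoidHom.add_apply, c11, c12, c14, c21, c22, c24, c41, c42, c44,
    add_zero, AddMonoidHom.zero_apply]

end Exhaustion

/-! ### Simple submodules and semisimplicity -/

section Semisimple

open Matrix

variable {F M : Type*} [Field F] [AddCommGroup M] {t : Fˣ} {k : ℕ}
  {ρ : SpecialLinearGroup (Fin 2) F →* AddMonoid.End M}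

/-- The additive span of `v`, `w v` and two differences of `w v`. -/
def fixedVectorSpan (ρ : SpecialLinearGroup (Fin 2) F →* AddMonoid.End M) (t : F) (v : M) :
    AddSubgroup M where
  carrier := {m | ∃ α β γ δ : ℤ, m = α • v + β • ρ (sl2Weyl F) v +
    γ • upperDiff ρ 1 (ρ (sl2Weyl F) v) + δ • upperDiff ρ t (ρ (sl2Weyl F) v)}
  zero_mem' := ⟨0, 0, 0, 0, by simp⟩
  add_mem' := by
    rintro _ _ ⟨α, β, γ, δ, rfl⟩ ⟨α', β', γ', δ', rfl⟩
    exact ⟨α + α', β + β', γ + γ', δ + δ', by module⟩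
  neg_mem' := by
    rintro _ ⟨α, β, γ, δ, rfl⟩
    exact ⟨-α, -β, -γ, -δ, by module⟩

lemma mem_fixedVectorSpan (t : F) (v : M) : v ∈ fixedVectorSpan ρ t v := ⟨1, 0, 0, 0, by simp⟩

lemma fixedVectorSpan_le {S : AddSubgroup M} {t : F} {v : M} (h1 : v ∈ S)
    (h2 : ρ (sl2Weyl F) v ∈ S) (h3 : ∀ x, upperDiff ρ x (ρ (sl2Weyl F) v) ∈ S) :
    fixedVectorSpan ρ t v ≤ S := by
  rintro _ ⟨α, β, γ, δ, rfl⟩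
  exact add_mem (add_mem (add_mem (zsmul_mem h1 _) (zsmul_mem h2 _)) (zsmul_mem (h3 _) _))
    (zsmul_mem (h3 _) _)

lemma weyl_mem_fixedVectorSpan (t : F) (v : M) : ρ (sl2Weyl F) v ∈ fixedVectorSpan ρ t v :=
  ⟨0, 1, 0, 0, by simp⟩

namespace IsPentagonal

variable [Finite M] (h : IsPentagonal ρ t) (hF : Nat.card F = 49) (ht : (t : F) ^ 2 = 1 - t)
  (hk : ∀ m : M, 7 ^ k • m = 0)

include h hF ht hk

/-- Differences of $wv$ are additive in $x$ modulo multiples of $v$, and the field is additively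
generated by $1$ and $t$. -/
lemma upperDiff_mem_fixedVectorSpan {v : M} (hv : v ∈ upperFixed ρ) (x : F) :
    upperDiff ρ x (ρ (sl2Weyl F) v) ∈ fixedVectorSpan ρ (t : F) v := by
  let γ : F →+ M ⧸ AddSubgroup.zmultiples v :=
    AddMonoidHom.mk' (fun x => (upperDiff ρ x (ρ (sl2Weyl F) v) : M)) fun x y => by
      obtain ⟨n, hn⟩ := h.upperDiff_add_weyl hF ht hk hv x y
      rw [hn, QuotientAddGroup.mk_add, QuotientAddGroup.mk_add, add_eq_left,
        QuotientAddGroup.eq_zero_iff]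
      exact ⟨n, rfl⟩
  obtain ⟨i, j, rfl⟩ := exists_eq_add_zsmul hF ht x
  have hγ : γ (i • 1 + j • (t : F)) = i • γ 1 + j • γ t := by
    rw [map_add, map_zsmul, map_zsmul]
  have : ((i • upperDiff ρ 1 (ρ (sl2Weyl F) v) + j • upperDiff ρ t (ρ (sl2Weyl F) v) : M) :
      M ⧸ AddSubgroup.zmultiples v) = (upperDiff ρ (i • 1 + j • (t : F)) (ρ (sl2Weyl F) v) : M) :=
    hγ.symm
  rw [QuotientAddGroup.eq] at this
  obtain ⟨n, hn⟩ := this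
  exact ⟨n, 0, i, j, by
    have hn' : n • v = -(i • upperDiff ρ 1 (ρ (sl2Weyl F) v) +
      j • upperDiff ρ t (ρ (sl2Weyl F) v)) +
        upperDiff ρ (i • 1 + j • (t : F)) (ρ (sl2Weyl F) v) := hn
    rw [hn']; module⟩

lemma fixedVectorSpan_invariant {v : M} (hv : v ∈ upperFixed ρ) (s) :
    ∀ m ∈ fixedVectorSpan ρ (t : F) v, ρ s m ∈ fixedVectorSpan ρ (t : F) v := by
  have hD := h.upperDiff_mem_fixedVectorSpan hF ht hk hv
  refine sl2_induction
    (P := fun s => ∀ m ∈ fixedVectorSpan ρ (t : F) v, ρ s m ∈ fixedVectorSpan ρ (t : F) v)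
    ?_ ?_ ?_ ?_ s
  · intro s s' hs hs' m hm
    rw [map_mul_apply_apply]
    exact hs _ (hs' m hm)
  · intro x
    refine fixedVectorSpan_le
        (S := (fixedVectorSpan ρ (t : F) v).comap (ρ (sl2Upper x) : M →+ M)) ?_ ?_ ?_
    · change ρ (sl2Upper x) v ∈ fixedVectorSpan ρ (t : F) v
      rw [upper_apply_of_mem hv]
      exact mem_fixedVectorSpan _ v
    · change ρ (sl2Upper x) (ρ (sl2Weyl F) v) ∈ fixedVectorSpan ρ (t : F) v
      rw [upper_apply]
      exact add_mem (weyl_mem_fixedVectorSpan _ v) (hD x)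
    · intro y
      change ρ (sl2Upper x) (upperDiff ρ y (ρ (sl2Weyl F) v)) ∈ fixedVectorSpan ρ (t : F) v
      rw [upper_apply]
      refine add_mem (hD y) ?_
      obtain ⟨i, j, rfl⟩ := exists_eq_add_zsmul hF ht x
      obtain ⟨i', j', rfl⟩ := exists_eq_add_zsmul hF ht y
      rw [(h.diffForm_weyl hF ht hk hv).2]
      exact zsmul_mem (mem_fixedVectorSpan _ v) _
  · intro a
    obtain ⟨n, hn : n • v = _⟩ := h.torus_apply_mem_zmultiples hF ht hk hv a
    obtain ⟨n', hn' : n' • v = _⟩ := h.torus_apply_mem_zmultiples hF ht hk hv a⁻¹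
    refine fixedVectorSpan_le
        (S := (fixedVectorSpan ρ (t : F) v).comap (ρ (sl2Torus a) : M →+ M)) ?_ ?_ ?_
    · change ρ (sl2Torus a) v ∈ fixedVectorSpan ρ (t : F) v
      rw [← hn]
      exact zsmul_mem (mem_fixedVectorSpan _ v) _
    · change ρ (sl2Torus a) (ρ (sl2Weyl F) v) ∈ fixedVectorSpan ρ (t : F) v
      rw [torus_weyl, ← hn', map_zsmul]
      exact zsmul_mem (weyl_mem_fixedVectorSpan _ v) _
    · intro y
      change ρ (sl2Torus a) (upperDiff ρ y (ρ (sl2Weyl F) v)) ∈ fixedVectorSpan ρ (t : F) v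
      rw [torus_upperDiff, torus_weyl, ← hn', map_zsmul, map_zsmul]
      exact zsmul_mem (hD _) _
  · refine fixedVectorSpan_le
      (S := (fixedVectorSpan ρ (t : F) v).comap (ρ (sl2Weyl F) : M →+ M)) ?_ ?_ ?_
    · exact weyl_mem_fixedVectorSpan _ v
    · change ρ (sl2Weyl F) (ρ (sl2Weyl F) v) ∈ fixedVectorSpan ρ (t : F) v
      rw [h.weyl_weyl]
      exact mem_fixedVectorSpan _ v
    · intro y
      change ρ (sl2Weyl F) (upperDiff ρ y (ρ (sl2Weyl F) v)) ∈ fixedVectorSpan ρ (t : F) v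
      by_cases hy : y = 0
      · rw [hy, upperDiff_zero, map_zero]; exact zero_mem _
      · lift y to Fˣ using IsUnit.mk0 y hy
        obtain ⟨n, hn : n • v = _⟩ := h.torus_apply_mem_zmultiples hF ht hk hv y
        rw [h.weyl_upperDiff_weyl hv, ← hn, map_zsmul, map_zsmul]
        exact sub_mem (add_mem (zsmul_mem (weyl_mem_fixedVectorSpan _ v) _) (zsmul_mem (hD _) _))
          (mem_fixedVectorSpan _ v)

/-- The span of a fixed vector of the unipotent group contains no proper submodule. -/
lemma mem_of_le_fixedVectorSpan {v : M} (hv : v ∈ upperFixed ρ) {N : AddSubgroup M}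
    (hN : ∀ s, ∀ m ∈ N, ρ s m ∈ N) (hN0 : N ≠ ⊥)
    (hle : N ≤ fixedVectorSpan ρ (t : F) v) : v ∈ N := by
  have : Fact (Nat.Prime 7) := ⟨by norm_num⟩
  have h7F := seven_eq_zero hF ht
  have : CharP F 7 := (CharP.charP_iff_prime_eq_zero (by norm_num)).mpr (by exact_mod_cast h7F)
  have : Finite F := Nat.finite_of_card_ne_zero (by omega)
  obtain ⟨m, hmN, hm0, hm⟩ := exists_upperDiff_mem ρ hk (P := N) (Q := ⊥)
    (fun x m hm => sub_mem (hN _ m hm) hm) (fun x m hm => by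
      rw [(AddSubgroup.mem_bot).mp hm, map_zero]; exact zero_mem _)
    (fun hle => hN0 (le_bot_iff.mp hle))
  simp only [AddSubgroup.mem_bot] at hm0 hm
  obtain ⟨hv7, hform⟩ := h.diffForm_weyl hF ht hk hv
  obtain ⟨α, β, γ, δ, rfl⟩ := hle hmN
  have f11 := hform 1 0 1 0
  have f1t := hform 1 0 0 1
  have ft1 := hform 0 1 1 0
  have ftt := hform 0 1 0 1
  simp only [one_smul, zero_smul, add_zero, zero_add] at f11 f1t ft1 ftt
  -- $D_1D_1m=2\beta v$ removes the coefficient of $wv$.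
  have hβ : β • v = 0 := by
    have := congrArg (upperDiff ρ 1) (hm 1)
    simp only [map_add, map_zsmul, hv 1, smul_zero, zero_add, f11, f1t, map_zero, add_zero] at this
    linear_combination (norm := module) (4 : ℤ) • this - β • hv7
  have hwβ : β • ρ (sl2Weyl F) v = 0 := by rw [← map_zsmul, hβ, map_zero]
  simp only [hwβ, add_zero, map_add, map_zsmul, hv _, smul_zero, zero_add] at hm
  have h1 := hm 1
  have h2 := hm t
  rw [f11, f1t] at h1
  rw [ft1, ftt] at h2
  -- The equations $2\gamma-\delta=0$ and $-\gamma-2\delta=0$ have determinant $-5$, a unit modulo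
  -- 7: the norm form is nondegenerate.
  have hδ : δ • v = 0 := by
    linear_combination (norm := module) (4 : ℤ) • h1 + h2 + (δ - γ) • hv7
  have hγ : γ • v = 0 := by
    linear_combination (norm := module) -h2 - (2 : ℤ) • hδ
  have e1 : γ • upperDiff ρ 1 (ρ (sl2Weyl F) v) = 0 := by
    rw [← map_zsmul, ← map_zsmul, hγ, map_zero, map_zero]
  have e2 : δ • upperDiff ρ t (ρ (sl2Weyl F) v) = 0 := by
    rw [← map_zsmul, ← map_zsmul, hδ, map_zero, map_zero]
  rw [hwβ, e1, e2, add_zero, add_zero, add_zero] at hmN hm0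
  have hα : IsCoprime α 7 := by
    rw [isCoprime_comm, (Int.prime_iff_natAbs_prime.mpr (by norm_num)).coprime_iff_not_dvd]
    rintro ⟨l, rfl⟩
    exact hm0 (by rw [mul_comm, mul_zsmul, hv7, zsmul_zero])
  obtain ⟨p, q, hpq⟩ := hα
  have : v = p • α • v := by
    rw [smul_smul, show p * α = 1 - q * 7 by linear_combination hpq]
    linear_combination (norm := module) q • hv7
  rw [this]
  exact zsmul_mem hmN p

/-- A pentagonal `7`-group is semisimple. -/
lemma isSemisimpleModule {R : Type*} [Ring R] [Module R M]
    (hsmul : ∀ S : AddSubgroup M, (∀ s, ∀ m ∈ S, ρ s m ∈ S) → ∀ r : R, ∀ m ∈ S, r • m ∈ S)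
    (hρ : ∀ (N : Submodule R M) s, ∀ m ∈ N, ρ s m ∈ N) : IsSemisimpleModule R M := by
  let p (v : {v // v ∈ upperFixed ρ ∧ v ≠ 0}) : Submodule R M :=
    { fixedVectorSpan ρ (t : F) (v : M) with
      smul_mem' := hsmul _ (h.fixedVectorSpan_invariant hF ht hk v.2.1) }
  refine isSemisimpleModule_of_isSemisimpleModule_submodule' (p := p) (fun v => ?_) ?_
  · have : IsAtom (p v) := by
      refine ⟨fun hb => v.2.2 ?_, fun N hN => ?_⟩
      · have : (v : M) ∈ p v := mem_fixedVectorSpan _ _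
        rw [hb] at this
        exact (Submodule.mem_bot R).mp this
      · by_contra hN0
        have hvN : (v : M) ∈ N := h.mem_of_le_fixedVectorSpan hF ht hk v.2.1
          (N := N.toAddSubgroup) (hρ N) (fun hb => hN0 ((Submodule.eq_bot_iff _).mpr fun m hm =>
            (AddSubgroup.eq_bot_iff_forall _).mp hb m hm)) hN.le
        refine hN.not_ge (fixedVectorSpan_le (S := N.toAddSubgroup) hvN (hρ N _ _ hvN) fun x => ?_)
        exact sub_mem (hρ N _ _ (hρ N _ _ hvN)) (hρ N _ _ hvN)
    have := isSimpleModule_iff_isAtom.mpr this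
    infer_instance
  · refine top_le_iff.mp fun m _ => ?_
    have hm : m ∈ fixedSpan ρ := h.fixedSpan_eq_top hF ht hk ▸ AddSubgroup.mem_top m
    have hp (v) (hv : v ∈ upperFixed ρ) :
        fixedVectorSpan ρ (t : F) v ≤ (⨆ v, p v).toAddSubgroup := by
      by_cases hv0 : v = 0
      · rintro _ ⟨α, β, γ, δ, rfl⟩
        simp [hv0]
      · exact fun m hm => (le_iSup p ⟨v, hv, hv0⟩ : _) hm
    exact fixedSpan_le (S := (⨆ v, p v).toAddSubgroup)
      (fun v hv => hp v hv (mem_fixedVectorSpan _ v))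
      (fun v hv x => hp v hv (h.upperDiff_mem_fixedVectorSpan hF ht hk hv x))
      (fun v hv => hp v hv (weyl_mem_fixedVectorSpan _ v)) hm

end IsPentagonal

end Semisimple

/-! ### Exclusion of primes other than 5 and 7 -/

section CoprimeCharacteristic

open Matrix TensorProduct

variable {F : Type*} [Field F] {t : Fˣ}

lemma IsPentagonal.map {A B : Type*} [Ring A] [Ring B] {ρ : SpecialLinearGroup (Fin 2) F →* A}
    (h : IsPentagonal ρ t) (f : A →+* B) : IsPentagonal ((f : A →* B).comp ρ) t where
  map_neg_one := by
    rw [MonoidHom.comp_apply, h.map_neg_one, map_one]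
  relation c y z hy hz := by
    simpa using congrArg f (h.relation c y z hy hz)

/-- The additive endomorphisms of a vector space over a prime field are linear. -/
def endToZModEnd (r : ℕ) (M : Type*) [AddCommGroup M] [Module (ZMod r) M] :
    AddMonoid.End M →+* Module.End (ZMod r) M where
  toFun f := AddMonoidHom.toZModLinearMap r f
  map_one' := rfl
  map_mul' _ _ := rfl
  map_zero' := rfl
  map_add' _ _ := rfl

variable {M : Type*} [AddCommGroup M] {ρ : SpecialLinearGroup (Fin 2) F →* AddMonoid.End M}

/-- A nontrivial vector space over a prime field can only be pentagonal in characteristics 5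
and 7. -/
lemma IsPentagonal.subsingleton_of_zmod (h : IsPentagonal ρ t) (hF : Nat.card F = 49)
    (ht : (t : F) ^ 2 = 1 - t) {r : ℕ} [Fact r.Prime] (h5 : r ≠ 5) (h7 : r ≠ 7)
    [Module (ZMod r) M] : Subsingleton M := by
  have : Finite F := Nat.finite_of_card_ne_zero (by omega)
  have := Fintype.ofFinite F
  let K := AlgebraicClosure (ZMod r)
  have hne {p : ℕ} (hp : p.Prime) (hr : r ≠ p) : (p : K) ≠ 0 := by
    rw [Ne, CharP.cast_eq_zero_iff K r, Nat.prime_dvd_prime_iff_eq Fact.out hp]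
    exact hr
  have h7K : ((7 : ℕ) : K) ≠ 0 := hne (by norm_num) h7
  have : NeZero ((7 : ℕ) : K) := ⟨h7K⟩
  obtain ⟨ζ, hζ⟩ := HasEnoughRootsOfUnity.exists_primitiveRoot K 7
  have h1 := (h.map (B := Module.End K (K ⊗[ZMod r] M)) ((Module.End.baseChangeHom (ZMod r) K M :
    Module.End (ZMod r) M →+* Module.End K (K ⊗[ZMod r] M)).comp (endToZModEnd r M))).one_eq_zero
    hF ht hζ
    (by exact_mod_cast hne (p := 5) (by norm_num) h5) (by exact_mod_cast h7K)
  refine subsingleton_of_forall_eq 0 fun m =>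
    Module.FaithfullyFlat.tensorProduct_mk_injective (A := ZMod r) (B := K) M ?_
  have := LinearMap.congr_fun h1 ((1 : K) ⊗ₜ[ZMod r] m)
  simpa using this

/-- A nontrivial pentagonal `r`-group has `r = 5` or `r = 7`. -/
lemma IsPentagonal.subsingleton (h : IsPentagonal ρ t) (hF : Nat.card F = 49)
    (ht : (t : F) ^ 2 = 1 - t) {r : ℕ} [Fact r.Prime] (h5 : r ≠ 5) (h7 : r ≠ 7) {k : ℕ}
    (hk : ∀ m : M, r ^ k • m = 0) : Subsingleton M := by
  -- $M/rM$ is a pentagonal vector space, hence zero; so $M=rM=\dots=r^kM=0$.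
  let S : AddSubgroup M := (nsmulAddMonoidHom r : M →+ M).range
  have hS : ∀ s, ∀ m ∈ S, ρ s m ∈ S := by
    rintro s _ ⟨m, rfl⟩
    exact ⟨ρ s m, (map_nsmul (ρ s) r m).symm⟩
  let _ : Module (ZMod r) (M ⧸ S) := AddCommGroup.zmodModule fun m => by
    obtain ⟨m, rfl⟩ := QuotientAddGroup.mk_surjective m
    exact (QuotientAddGroup.eq_zero_iff _).mpr ⟨m, rfl⟩
  have := (h.quotientAction hS).subsingleton_of_zmod hF ht h5 h7
  have hdiv (m : M) : ∃ n : M, r • n = m :=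
    (QuotientAddGroup.eq_zero_iff m).mp (Subsingleton.elim (m : M ⧸ S) 0)
  have hpow (j : ℕ) (m : M) : ∃ n : M, r ^ j • n = m := by
    induction j with
    | zero => exact ⟨m, by simp⟩
    | succ j ih =>
      obtain ⟨n, hn⟩ := ih
      obtain ⟨n', rfl⟩ := hdiv n
      exact ⟨n', by rw [← hn, pow_succ, mul_nsmul']⟩
  refine subsingleton_of_forall_eq 0 fun m => ?_
  obtain ⟨n, rfl⟩ := hpow k m
  exact hk n

end CoprimeCharacteristic

/-! ### From fixed-point-freeness to the pentagon relations -/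

section InducedAction

open Matrix

variable {Γ F : Type*} [Group Γ] [Field F] {W : Subgroup Γ} [W.Normal]

/-- Automorphisms of a commutative group as additive endomorphisms. -/
def mulAutToEnd (B : Type*) [CommGroup B] : MulAut B →* AddMonoid.End (Additive B) where
  toFun e := MonoidHom.toAdditive e.toMonoidHom
  map_one' := rfl
  map_mul' _ _ := rfl

/-- The action on a commutative group obtained by lifting from a quotient group. -/
def inducedAction {B : Type*} [CommGroup B] (ψ : SpecialLinearGroup (Fin 2) F →* Γ ⧸ W)
    (D : Γ →* MulAut B) (hD : ∀ w ∈ W, D w = 1) :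
    SpecialLinearGroup (Fin 2) F →* AddMonoid.End (Additive B) :=
  (mulAutToEnd B).comp ((QuotientGroup.lift W D hD).comp ψ)

lemma inducedAction_apply {B : Type*} [CommGroup B]
    {ψ : SpecialLinearGroup (Fin 2) F →* Γ ⧸ W} {D : Γ →* MulAut B} (hD : ∀ w ∈ W, D w = 1)
    {s : SpecialLinearGroup (Fin 2) F} {γ : Γ} (h : ψ s = γ) (b : B) :
    inducedAction ψ D hD s (Additive.ofMul b) = Additive.ofMul (D γ b) := by
  change Additive.ofMul (QuotientGroup.lift W D hD (ψ s) b) = _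
  rw [h]
  rfl

/-- The homomorphism `ψ` is trivial on `-1` and maps some element of order five and trace `t`
to the coset of `γ`. -/
structure CoversOrderFive (ψ : SpecialLinearGroup (Fin 2) F →* Γ ⧸ W) (γ : Γ) (t : Fˣ) :
    Prop where
  map_neg_one : ψ (-1) = 1
  exists_preimage : ∃ s, ψ s = γ ∧ s ^ 5 = 1 ∧ s 0 0 + s 1 1 = t ∧ s 1 0 ≠ 0
  sq_eq : (t : F) ^ 2 = 1 - t

/-- If an element of order five acts without fixed points, then the action is pentagonal. -/
lemma CoversOrderFive.isPentagonal {B : Type*} [CommGroup B] [Finite B] (hF : Nat.card F = 49)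
    {ψ : SpecialLinearGroup (Fin 2) F →* Γ ⧸ W} {γ : Γ} {t : Fˣ} (h : CoversOrderFive ψ γ t)
    {D : Γ →* MulAut B} (hD : ∀ w ∈ W, D w = 1) (hfix : MonoidHom.FixedPointFree (D γ)) :
    IsPentagonal (inducedAction ψ D hD) t := by
  obtain ⟨s, hs, h5, htr, h10⟩ := h.exists_preimage
  refine .of_sum_eq_zero hF ?_ s h5 htr h.sq_eq h10 ?_
  · refine DFunLike.ext _ _ fun b => ?_
    exact (inducedAction_apply hD (γ := 1) (by rw [h.map_neg_one]; rfl) b.toMul).trans (by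
      rw [map_one]; rfl)
  · have hpow (k : ℕ) (b : B) :
        inducedAction ψ D hD (s ^ k) (Additive.ofMul b) = Additive.ofMul ((D γ)^[k] b) := by
      rw [inducedAction_apply hD (γ := γ ^ k) (by rw [map_pow, hs]; rfl), map_pow]
      congr 1
      induction k with
      | zero => rfl
      | succ k ih => rw [Function.iterate_succ_apply', ← ih, pow_succ']; rfl
    have hid : (D γ)^[5] = id := by
      funext b
      refine Additive.ofMul.injective ((hpow 5 b).symm.trans ?_)
      rw [h5, map_one]; rfl
    refine DFunLike.ext _ _ fun b => ?_
    have := hfix.prod_pow_eq_one hid b.toMul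
    rw [AddMonoid.End.zero_apply, ← ofMul_one, ← this, List.prod_range_succ, List.prod_range_succ,
      List.prod_range_succ, List.prod_range_succ, List.prod_range_succ]
    simp only [Finset.sum_range_succ, Finset.sum_range_zero, List.range_zero, List.map_nil,
      List.prod_nil, ofMul_mul, ← hpow]
    rfl

end InducedAction

/-! ### Actions on quotients, centers and commutators -/

section Commutators

open scoped commutatorElement

/-- The action of automorphisms on the quotient by a characteristic subgroup. -/
def quotientAut {V : Type*} [Group V] (K : Subgroup V) [K.Characteristic] :
    MulAut V →* MulAut (V ⧸ K) where
  toFun e := QuotientGroup.congr K K e (Subgroup.characteristic_iff_map_eq.mp ‹_› e)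
  map_one' := by
    ext x
    obtain ⟨x, rfl⟩ := QuotientGroup.mk_surjective x
    rfl
  map_mul' e f := by
    ext x
    obtain ⟨x, rfl⟩ := QuotientGroup.mk_surjective x
    rfl

lemma quotientAut_mk {V : Type*} [Group V] (K : Subgroup V) [K.Characteristic] (e : MulAut V)
    (x : V) : quotientAut K e (x : V ⧸ K) = (e x : V) := rfl

/-- The center of a group, as a commutative group. -/
def CenterGroup (V : Type*) [Group V] : Type _ := Subgroup.center V

instance (V : Type*) [Group V] : CommGroup (CenterGroup V) :=
  { (inferInstance : Group (Subgroup.center V)) with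
    mul_comm := fun x y => Subtype.ext (Subgroup.mem_center_iff.mp y.2 x.1) }

instance (V : Type*) [Group V] [Finite V] : Finite (CenterGroup V) :=
  inferInstanceAs (Finite (Subgroup.center V))

/-- The inclusion of the center. -/
def CenterGroup.subtype (V : Type*) [Group V] : CenterGroup V →* V :=
  (Subgroup.center V).subtype

lemma CenterGroup.subtype_injective (V : Type*) [Group V] :
    Function.Injective (CenterGroup.subtype V) := Subtype.val_injective

/-- The action of automorphisms on the center. -/
def centerAut (V : Type*) [Group V] : MulAut V →* MulAut (CenterGroup V) where
  toFun e := Subgroup.centerCongr e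
  map_one' := rfl
  map_mul' _ _ := rfl

/-- The action of automorphisms on the abelianization. -/
def abelianizationAut (V : Type*) [Group V] : MulAut V →* MulAut (Abelianization V) where
  toFun e := e.abelianizationCongr
  map_one' := abelianizationCongr_refl
  map_mul' e f := by
    ext x
    obtain ⟨x, rfl⟩ := QuotientGroup.mk_surjective x
    rfl

/-- Inner automorphisms act trivially on the abelianization. -/
lemma abelianizationAut_comp_eq_one {Γ V : Type*} [Group Γ] [Group V] {W : Subgroup Γ}
    {Φ : Γ →* MulAut V} (hin : ∀ w ∈ W, ∃ v, Φ w = MulAut.conj v) :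
    ∀ w ∈ W, (abelianizationAut V).comp Φ w = 1 := fun w hw => by
  obtain ⟨v, hv⟩ := hin w hw
  ext x
  obtain ⟨x, rfl⟩ := QuotientGroup.mk_surjective x
  rw [MonoidHom.comp_apply, hv]
  change Abelianization.of (v * x * v⁻¹) = Abelianization.of x
  rw [map_mul, map_mul, mul_comm (Abelianization.of v), mul_assoc, ← map_mul, mul_inv_cancel,
    map_one, mul_one]

lemma nsmul_additive_abelianization_eq_zero {V : Type*} [Group V] {n : ℕ}
    (h : ∀ x : V, x ^ n = 1) (x : Additive (Abelianization V)) : n • x = 0 := by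
  obtain ⟨x, rfl⟩ := Additive.ofMul.surjective x
  obtain ⟨y, rfl⟩ : ∃ y, Abelianization.of y = x := QuotientGroup.mk_surjective x
  rw [← ofMul_pow, ← map_pow, h, map_one]; rfl

/-- Fixed-point-freeness passes to quotients. -/
lemma fixedPointFree_of_quotient {V : Type*} [Group V] [Finite V] (K : Subgroup V)
    [K.Characteristic] {e : MulAut V} (he : MonoidHom.FixedPointFree e) :
    MonoidHom.FixedPointFree (quotientAut K e) := by
  intro x hx
  obtain ⟨x, rfl⟩ := QuotientGroup.mk_surjective x
  have hK (y : K) : e y ∈ K := by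
    have := Subgroup.characteristic_iff_map_eq.mp ‹_› e
    exact this.le (Subgroup.mem_map_of_mem _ y.2)
  -- $y\mapsto y\,e(y)^{-1}$ is injective, hence onto the finite $K$. A fixed coset of $x$ has
  -- $x\,e(x)^{-1}\in K$, so $x$ is one of these $y$.
  let f : K → K := fun y => ⟨MonoidHom.commutatorMap e y, K.div_mem y.2 (hK y)⟩
  have hf : Function.Injective f := fun y z hyz =>
    Subtype.ext (he.commutatorMap_injective (congrArg Subtype.val hyz))
  rw [quotientAut_mk, eq_comm, QuotientGroup.eq_iff_div_mem] at hx
  obtain ⟨y, hy⟩ := Finite.surjective_of_injective hf ⟨_, hx⟩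
  rw [← he.commutatorMap_injective (congrArg Subtype.val hy), QuotientGroup.eq_one_iff]
  exact y.2

lemma fixedPointFree_abelianizationAut {V : Type*} [Group V] [Finite V] {e : MulAut V}
    (he : MonoidHom.FixedPointFree e) : MonoidHom.FixedPointFree (abelianizationAut V e) :=
  fixedPointFree_of_quotient _ he

/-- In a group of class two the commutator gives a bimultiplicative map from the abelianization
to the center. -/
def commutatorHom {V : Type*} [Group V] (h : ∀ x y : V, ⁅x, y⁆ ∈ Subgroup.center V) :
    Abelianization V →* Abelianization V →* CenterGroup V :=
  Abelianization.lift
    { toFun := fun x => Abelianization.lift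
        { toFun := fun y => ⟨⁅x, y⁆, h x y⟩
          map_one' := Subtype.ext (commutatorElement_one_right x)
          map_mul' := fun y z => by
            refine Subtype.ext ?_
            have := Subgroup.mem_center_iff.mp (h x z) y⁻¹
            change ⁅x, y * z⁆ = ⁅x, y⁆ * ⁅x, z⁆
            calc ⁅x, y * z⁆ = x * y * x⁻¹ * (⁅x, z⁆ * y⁻¹) := by
                  simp only [commutatorElement_def]; group
              _ = ⁅x, y⁆ * ⁅x, z⁆ := by
                  rw [← this, commutatorElement_def x y]; simp only [mul_assoc] }
      map_one' := by
        refine MonoidHom.ext fun z => ?_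
        obtain ⟨z, rfl⟩ := QuotientGroup.mk_surjective z
        exact Subtype.ext (commutatorElement_one_left z)
      map_mul' := fun x y => by
        refine MonoidHom.ext fun z => ?_
        obtain ⟨z, rfl⟩ := QuotientGroup.mk_surjective z
        refine Subtype.ext ?_
        have := Subgroup.mem_center_iff.mp (h y z) x
        change ⁅x * y, z⁆ = ⁅x, z⁆ * ⁅y, z⁆
        calc ⁅x * y, z⁆ = (x * ⁅y, z⁆) * (z * x⁻¹ * z⁻¹) := by
              simp only [commutatorElement_def]; group
          _ = ⁅y, z⁆ * ⁅x, z⁆ := by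
              rw [this, commutatorElement_def x z]; simp only [mul_assoc]
          _ = ⁅x, z⁆ * ⁅y, z⁆ := (Subgroup.mem_center_iff.mp (h y z) _).symm }

lemma subtype_commutatorHom_of {V : Type*} [Group V]
    (h : ∀ x y : V, ⁅x, y⁆ ∈ Subgroup.center V) (x y : V) :
    CenterGroup.subtype V (commutatorHom h (Abelianization.of x) (Abelianization.of y)) =
      ⁅x, y⁆ := rfl

end Commutators

/-! ### Commutativity of the normal subgroup -/

section Commutativity

open Matrix
open scoped commutatorElement

universe u

variable {Γ F : Type*} [Group Γ] [Field F] {W : Subgroup Γ} [W.Normal]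
  {ψ : SpecialLinearGroup (Fin 2) F →* Γ ⧸ W} {γ : Γ} {t : Fˣ}

lemma nontrivial_abelianization (V : Type*) [Group V] [Nontrivial V] [Group.IsSolvable V] :
    Nontrivial (Abelianization V) := by
  by_contra h
  rw [not_nontrivial_iff_subsingleton] at h
  refine (Group.IsSolvable.commutator_lt_top_of_nontrivial V).ne (top_le_iff.mp fun x _ => ?_)
  rw [← Abelianization.ker_of]
  exact Subsingleton.elim (Abelianization.of x) 1

/-- An element of order five can act without fixed points on a nontrivial `r`-group only for
`r = 5` and `r = 7`. -/
lemma CoversOrderFive.subsingleton_of_isPGroup (h : CoversOrderFive ψ γ t)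
    (hF : Nat.card F = 49) {r : ℕ} [Fact r.Prime] (h5 : r ≠ 5) (h7 : r ≠ 7) {V : Type*} [Group V]
    [Finite V] (hp : IsPGroup r V) {Φ : Γ →* MulAut V} (hin : ∀ w ∈ W, ∃ v, Φ w = MulAut.conj v)
    (hfix : MonoidHom.FixedPointFree (Φ γ)) : Subsingleton V := by
  by_contra hV
  rw [not_subsingleton_iff_nontrivial] at hV
  obtain ⟨k, hk⟩ : ∃ k, ∀ x : V, x ^ r ^ k = 1 := by
    obtain ⟨k, hk⟩ := IsPGroup.iff_card.mp hp
    exact ⟨k, fun x => hk ▸ pow_card_eq_one'⟩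
  have hpent := h.isPentagonal hF (abelianizationAut_comp_eq_one hin)
    (fixedPointFree_abelianizationAut hfix)
  have hsub := hpent.subsingleton hF h.sq_eq h5 h7 (k := k)
    (nsmul_additive_abelianization_eq_zero hk)
  have := hp.isNilpotent
  have := nontrivial_abelianization V
  exact not_subsingleton _ (Additive.ofMul.subsingleton_congr.mpr hsub)

/-- A `7`-group on which an element of order five acts without fixed points is commutative. -/
lemma CoversOrderFive.mul_comm_of_isPGroup (h : CoversOrderFive ψ γ t) (hF : Nat.card F = 49)
    (n : ℕ) {V : Type u} [Group V] [Finite V] (hn : Nat.card V = n) (hp : IsPGroup 7 V)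
    (Φ : Γ →* MulAut V) (hin : ∀ w ∈ W, ∃ v, Φ w = MulAut.conj v)
    (hfix : MonoidHom.FixedPointFree (Φ γ)) (x y : V) : x * y = y * x := by
  have : Fact (Nat.Prime 7) := ⟨by norm_num⟩
  induction n using Nat.strong_induction_on generalizing V with
  | _ n ih =>
  rcases subsingleton_or_nontrivial V with hV | hV
  · exact Subsingleton.elim _ _
  have hZ := hp.center_nontrivial
  -- the quotient by the center is commutative by induction
  have hcomm (x y : V) : ⁅x, y⁆ ∈ Subgroup.center V := by
    have := ih (Nat.card (V ⧸ Subgroup.center V)) (by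
      rw [← hn, ← (Subgroup.center V).index_mul_card]
      have h1 := (Subgroup.center V).index_ne_zero_of_finite
      have h2 := Finite.one_lt_card_iff_nontrivial.mpr hZ
      rw [Subgroup.index]
      rw [Subgroup.index] at h1
      nlinarith [Nat.pos_of_ne_zero h1]) rfl (hp.to_quotient _)
      ((quotientAut (Subgroup.center V)).comp Φ) (fun w hw => by
        obtain ⟨v, hv⟩ := hin w hw
        refine ⟨(v : V ⧸ _), ?_⟩
        rw [MonoidHom.comp_apply, hv]
        ext x
        obtain ⟨x, rfl⟩ := QuotientGroup.mk_surjective x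
        rfl) (fixedPointFree_of_quotient _ hfix) (x : V ⧸ _) (y : V ⧸ _)
    rw [← QuotientGroup.eq_one_iff]
    exact commutatorElement_eq_one_iff_mul_comm.mpr this
  obtain ⟨k, hk⟩ : ∃ k, ∀ x : V, x ^ 7 ^ k = 1 := by
    obtain ⟨k, hk⟩ := IsPGroup.iff_card.mp hp
    exact ⟨k, fun x => hk ▸ pow_card_eq_one'⟩
  have hD := abelianizationAut_comp_eq_one hin
  have hD' : ∀ w ∈ W, (centerAut V).comp Φ w = 1 := fun w hw => by
    obtain ⟨v, hv⟩ := hin w hw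
    refine MulEquiv.ext fun x => CenterGroup.subtype_injective V ?_
    rw [MonoidHom.comp_apply, hv]
    change v * CenterGroup.subtype V x * v⁻¹ = CenterGroup.subtype V x
    rw [Subgroup.mem_center_iff.mp (show CenterGroup.subtype V x ∈ Subgroup.center V from x.2) v,
      mul_assoc, mul_inv_cancel, mul_one]
  have hA := h.isPentagonal hF hD (fixedPointFree_abelianizationAut hfix)
  have hB := h.isPentagonal hF hD' fun x hx =>
    Subtype.ext (hfix _ (congrArg (CenterGroup.subtype V) hx))
  -- Automorphisms of $V$ respect commutators, so the pairing is equivariant between two pentagonal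
  -- 7-groups.
  let c : Additive (Abelianization V) →+ Additive (Abelianization V) →+
      Additive (CenterGroup V) :=
    AddMonoidHom.mk' (fun x => MonoidHom.toAdditive (commutatorHom hcomm x.toMul)) fun x y => by
      rw [toMul_add, map_mul]; rfl
  have hc := equivariant_biadditive_eq_zero (k := k) hA hB hF h.sq_eq
    (nsmul_additive_abelianization_eq_zero hk)
    (fun x => Subtype.ext (hk (CenterGroup.subtype V x.toMul))) c fun s x y => by
      obtain ⟨x, rfl⟩ := Additive.ofMul.surjective x
      obtain ⟨y, rfl⟩ := Additive.ofMul.surjective y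
      obtain ⟨g, hg⟩ := QuotientGroup.mk_surjective (ψ s)
      rw [inducedAction_apply hD hg.symm, inducedAction_apply hD hg.symm]
      refine Eq.trans ?_ (inducedAction_apply hD' hg.symm (commutatorHom hcomm x y)).symm
      obtain ⟨x, rfl⟩ := QuotientGroup.mk_surjective x
      obtain ⟨y, rfl⟩ := QuotientGroup.mk_surjective y
      refine congrArg Additive.ofMul (CenterGroup.subtype_injective V ?_)
      exact (map_commutatorElement (Φ g) x y).symm
  have : (commutatorHom hcomm (Abelianization.of x) (Abelianization.of y)) = 1 :=
    DFunLike.congr_fun (DFunLike.congr_fun hc (Additive.ofMul (Abelianization.of x)))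
      (Additive.ofMul (Abelianization.of y))
  rw [← commutatorElement_eq_one_iff_mul_comm, ← subtype_commutatorHom_of hcomm, this]
  rfl

end Commutativity

/-! ### Fixed points of $p$-elements -/

section PCore

variable {G : Type*} [Group G]

lemma isPGroup_pCore (p : ℕ) : IsPGroup p (pCore p G) :=
  Sylow.sSup_of_normal _ (fun _ h => h.2) fun _ h => h.1

/-- An element of prime order `p` has a nontrivial fixed point on a nontrivial `p`-group. -/
lemma not_actsFixedPointFreely_of_isPGroup [Finite G] {p : ℕ} [Fact p.Prime]
    {N : Subgroup G} [N.Normal]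
    (hN : IsPGroup p N) (hN1 : N ≠ ⊥) {g : G} (hg : orderOf g = p) :
    ¬ActsFixedPointFreely g N := by
  intro hfix
  let _ : MulAction (Subgroup.zpowers g) N :=
    MulAction.compHom N ((MulAut.conjNormal : G →* MulAut N).comp (Subgroup.zpowers g).subtype)
  have hp : IsPGroup p (Subgroup.zpowers g) := IsPGroup.of_card (n := 1) (by
    rw [Nat.card_zpowers, hg, pow_one])
  have : Nontrivial N := (Subgroup.nontrivial_iff_ne_bot N).mpr hN1
  have hcard : p ∣ Nat.card N := by
    obtain ⟨n, hn, hn'⟩ := hN.nontrivial_iff_card.mp this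
    rw [hn']; exact dvd_pow_self _ hn.ne'
  obtain ⟨x, hx, hx1⟩ := hp.exists_fixed_point_of_prime_dvd_card_of_fixed_point N hcard
    (a := 1) (fun k => map_one (MulAut.conjNormal (k : G)))
  have := hx ⟨g, Subgroup.mem_zpowers g⟩
  exact hx1 (Subtype.ext (hfix x x.2 (congrArg Subtype.val this)).symm)

end PCore

/-! ### Lifting to $\mathrm{SL}_2(49)$ -/

section Lifting

open Matrix

variable {F : Type*} [Field F]

lemma neg_one_mem_center : (-1 : SpecialLinearGroup (Fin 2) F) ∈ Subgroup.center _ :=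
  Subgroup.mem_center_iff.mpr fun g => by rw [mul_neg, neg_mul, mul_one, one_mul]

/-- A nontrivial element of order five of a quotient isomorphic to `PSL₂(49)` lifts to
`SL₂(49)`. -/
lemma exists_coversOrderFive {Γ : Type*} [Group Γ] {W : Subgroup Γ} [W.Normal]
    (hF : Nat.card F = 49) (e : Γ ⧸ W ≃* ProjectiveSpecialLinearGroup (Fin 2) F) {γ : Γ}
    (h5 : γ ^ 5 = 1) (hγ : γ ∉ W) :
    ∃ (ψ : SpecialLinearGroup (Fin 2) F →* Γ ⧸ W) (t : Fˣ),
      Function.Surjective ψ ∧ CoversOrderFive ψ γ t := by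
  let ψ : SpecialLinearGroup (Fin 2) F →* Γ ⧸ W :=
    e.symm.toMonoidHom.comp (QuotientGroup.mk' _)
  have hψ : Function.Surjective ψ :=
    e.symm.surjective.comp (QuotientGroup.mk'_surjective _)
  have hker {s} (hs : ψ s = 1) : s = 1 ∨ s = -1 := by
    have hs' : (s : ProjectiveSpecialLinearGroup (Fin 2) F) = 1 :=
      e.symm.injective (hs.trans (map_one e.symm).symm)
    obtain ⟨x, hx, hx'⟩ := Matrix.SpecialLinearGroup.mem_center_iff.mp
      ((QuotientGroup.eq_one_iff s).mp hs')
    rw [Fintype.card_fin, sq_eq_one_iff] at hx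
    refine hx.imp (fun h => ?_) fun h => ?_
    · ext i j
      rw [← hx', h]; simp
    · ext i j
      rw [← hx', h]; fin_cases i <;> fin_cases j <;> simp
  have hneg : ψ (-1) = 1 := by
    change e.symm ((-1 : SpecialLinearGroup (Fin 2) F) : ProjectiveSpecialLinearGroup (Fin 2) F) = 1
    rw [(QuotientGroup.eq_one_iff _).mpr neg_one_mem_center, map_one]
  -- A preimage has fifth power $\pm1$; as 5 is odd, changing its sign corrects $-1$.
  obtain ⟨s, hs, hs5⟩ : ∃ s, ψ s = γ ∧ s ^ 5 = 1 := by
    obtain ⟨s, hs⟩ := hψ γ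
    have : ψ (s ^ 5) = 1 := by
      rw [map_pow, hs, ← QuotientGroup.mk_pow, h5]; rfl
    rcases hker this with h | h
    · exact ⟨s, hs, h⟩
    · refine ⟨-1 * s, by rw [map_mul, hneg, one_mul, hs], ?_⟩
      rw [neg_one_mul, Odd.neg_pow (by decide), h, neg_neg]
  have hs1 : (s : Matrix (Fin 2) (Fin 2) F) ≠ 1 := fun h => hγ (by
    have : s = 1 := Subtype.ext h
    rw [← QuotientGroup.eq_one_iff, ← hs, this, map_one])
  obtain ⟨h10, htr⟩ := trace_of_pow_five hF s.2 (by
    exact congrArg Subtype.val hs5) hs1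
  have ht0 : s 0 0 + s 1 1 ≠ 0 := fun h0 => by
    change (s 0 0 + s 1 1) ^ 2 = 1 - (s 0 0 + s 1 1) at htr
    rw [h0] at htr
    norm_num at htr
  exact ⟨ψ, Units.mk0 _ ht0, hψ, hneg, ⟨s, hs, hs5, rfl, h10⟩, htr⟩

end Lifting

/-! ### The conjugation module -/

section ConjugationModule

variable {G : Type*} [Group G] {N : Subgroup G} [N.Normal]

namespace IsElementaryAbelian

/-- An additive subgroup invariant under the group is a submodule over the group algebra. -/
lemma smul_mem_of_invariant {p : ℕ} (h : IsElementaryAbelian p N)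
    (S : AddSubgroup h.conjRep.asModule)
    (hS : ∀ x : G ⧸ N, ∀ m ∈ S, (h.conjRep x (m : h.AsModule) : h.conjRep.asModule) ∈ S)
    (r : MonoidAlgebra (ZMod p) (G ⧸ N)) (m : h.conjRep.asModule) (hm : m ∈ S) : r • m ∈ S := by
  induction r using MonoidAlgebra.induction_linear with
  | zero => rw [zero_smul]; exact zero_mem _
  | add a b ha hb => rw [add_smul]; exact add_mem ha hb
  | single x c =>
    rw [Representation.single_smul]
    exact zmod_smul_mem (hS x m hm) c

end IsElementaryAbelian

end ConjugationModule

/-! ### The main theorem -/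

theorem lemma4p4 {G : Type*} [Group G] [Finite G] {F : Type*} [Field F] (hF : Nat.card F = 49)
    (r : ℕ) (hr : r.Prime) (hne : pCore r G ≠ ⊥)
    (hX : Nonempty (G ⧸ pCore r G ≃* Matrix.ProjectiveSpecialLinearGroup (Fin 2) F))
    (hfpf : ∃ g : G, orderOf g = 5 ∧ ActsFixedPointFreely g (pCore r G)) :
    r = 7 ∧ ∃ h : IsElementaryAbelian 7 (pCore 7 G),
      IsSemisimpleModule (MonoidAlgebra (ZMod 7) (G ⧸ pCore 7 G)) h.conjRep.asModule := by
  have : Fact r.Prime := ⟨hr⟩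
  have h7 : Fact (Nat.Prime 7) := ⟨by norm_num⟩
  obtain ⟨e⟩ := hX
  obtain ⟨g, hg, hfix⟩ := hfpf
  have hp := isPGroup_pCore (G := G) r
  have hr5 : r ≠ 5 := fun h =>
    not_actsFixedPointFreely_of_isPGroup hp hne (hg.trans h.symm) hfix
  have hgW : g ∉ pCore r G := fun hgW => by
    rw [hfix g hgW (by rw [mul_assoc, mul_inv_cancel, mul_one]), orderOf_one] at hg
    norm_num at hg
  obtain ⟨ψ, t, hψ, hcov⟩ := exists_coversOrderFive hF e (hg ▸ pow_orderOf_eq_one g) hgW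
  let Φ : G →* MulAut (pCore r G) := MulAut.conjNormal
  have hΦ : MonoidHom.FixedPointFree (Φ g) := fun x hx =>
    Subtype.ext (hfix x x.2 (congrArg Subtype.val hx))
  have hin : ∀ w ∈ pCore r G, ∃ v, Φ w = MulAut.conj v := fun w hw => ⟨⟨w, hw⟩, by
    ext x; rfl⟩
  have hr7 : r = 7 := by
    by_contra hr7
    have : Nontrivial (pCore r G) := (Subgroup.nontrivial_iff_ne_bot _).mpr hne
    exact not_subsingleton _ (hcov.subsingleton_of_isPGroup hF hr5 hr7 hp hin hΦ)
  subst hr7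
  obtain ⟨k, hk⟩ : ∃ k, ∀ x : pCore 7 G, x ^ 7 ^ k = 1 := by
    obtain ⟨k, hk⟩ := IsPGroup.iff_card.mp hp
    exact ⟨k, fun x => hk ▸ pow_card_eq_one'⟩
  have hcomm := hcov.mul_comm_of_isPGroup hF _ rfl hp Φ hin hΦ
  let _ : CommGroup (pCore 7 G) := { (inferInstance : Group (pCore 7 G)) with mul_comm := hcomm }
  have hΦ1 : ∀ w ∈ pCore 7 G, Φ w = 1 := fun w hw => by
    obtain ⟨v, hv⟩ := hin w hw
    rw [hv]
    ext x
    rw [MulAut.conj_apply, hcomm v x, mul_assoc, mul_inv_cancel, mul_one]; rfl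
  have hpent := hcov.isPentagonal hF hΦ1 hΦ
  have hk' : ∀ m : Additive (pCore 7 G), 7 ^ k • m = 0 := fun m => hk m.toMul
  have h : IsElementaryAbelian 7 (pCore 7 G) :=
    ⟨hcomm, fun x => by
      have := hpent.seven_zsmul_of_mem_fixedSpan hF hcov.sq_eq hk'
        (hpent.fixedSpan_eq_top hF hcov.sq_eq hk' ▸ AddSubgroup.mem_top (Additive.ofMul x))
      rw [← zpow_natCast]
      exact this⟩
  refine ⟨rfl, h, ?_⟩
  -- As $\psi$ is surjective, submodules over the group algebra of the quotient are the subgroups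
  -- invariant under $\mathrm{SL}_2(49)$.
  have hact (s : Matrix.SpecialLinearGroup (Fin 2) F) (m : Additive (pCore 7 G)) :
      inducedAction ψ Φ hΦ1 s m = h.conjRep (ψ s) m := by
    obtain ⟨γ, hγ⟩ := QuotientGroup.mk_surjective (ψ s)
    rw [← hγ]
    exact inducedAction_apply hΦ1 hγ.symm m.toMul
  let ρ : Matrix.SpecialLinearGroup (Fin 2) F →* AddMonoid.End h.conjRep.asModule :=
    inducedAction ψ Φ hΦ1
  have hρ : IsPentagonal ρ t := hpent
  have : Finite h.conjRep.asModule := inferInstanceAs (Finite (pCore 7 G))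
  refine hρ.isSemisimpleModule hF hcov.sq_eq (k := k) hk' (fun S hS => ?_) fun N s m hm => ?_
  · refine h.smul_mem_of_invariant S fun x m hm => ?_
    obtain ⟨s, rfl⟩ := hψ x
    exact hact s m ▸ hS s m hm
  · have := N.smul_mem (MonoidAlgebra.single (ψ s) 1) hm
    rw [Representation.single_smul, one_smul] at this
    exact hact s m ▸ this
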